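/- **Theorem 4.2.** For a Gaussian prime $\pi$ of odd norm $N\pi$ and $\alpha\in\mathbb Z[i]$ let $\left(\frac{\alpha}{\pi}\right)_4=0$ if $\pi\mid\alpha$, and otherwise let $\left(\frac{\alpha}{\pi}\right)_4\in\{1,i,-1,-i\}$ be determined by $\alpha^{(N\pi-1)/4}\equiv\left(\frac{\alpha}{\pi}\right)_4\pmod\pi$. For $\beta\in\mathbb Z[i]$ of odd norm, the quartic Jacobi symbol $\left(\frac{\alpha}{\beta}\right)_4$ is the product of the symbols $\left(\frac{\alpha}{\pi}\right)_4$ over the prime factors $\pi$ of $\beta$, counted with multiplicity (it is $1$ if $\beta$ is a unit). For an odd integer $m$ and rationals $a,b$ whose denominators are prime to $m$, put $\left(\frac{a+bi}{m}\right)_4=\left(\frac{n(a+bi)}{m}\right)_4\left(\frac{n}{m}\right)_4^{-1}$, where $n$ is a common denominator of $a$ and $b$ that is prime to $m$. Let $p$ be a prime with $p\equiv 1\pmod 4$, and let $q$ be an odd integer (of either sign) with $p\nmid q$. Suppose that $p=c^2+d^2=x^2+2qy^2$ with $c,d,x,y\in\mathbb Z$, $c\equiv 1\pmod 4$, $d=2^rd_0$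 with an integer $r\ge 0$, $d_0\equiv 1\pmod 4$ and $\gcd(d_0,x+c)=1$. (These conditions force $p\equiv 1\pmod 8$, $4\mid d$, $2\mid y$, $2\nmid x$, $p\nmid c$ and $x+c\neq 0$, and $x+c$ is prime to $q$.) If $k$ is an integer with $$\left(\frac{-d/(x+c)+i}{q}\right)_4=i^k,$$ then $$(-q)^{\frac{p-1}8}\equiv\begin{cases}(-1)^{\frac{x+1}2\cdot\frac{q-1}4+\frac d4+\frac y2}\left(\frac dc\right)^k\pmod p&\text{if } q\equiv 1\pmod 4,\\[4pt](-1)^{\frac{x+1}2\cdot\frac{q+1}4}\left(\frac dc\right)^k\pmod p&\text{if } q\equiv 3\pmod 4,\end{cases}$$ where $d/c$ is the quotient of the residue classes of $d$ and $c$ modulo $p$. -/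

import Mathlib

/-- The Gaussian integer `i`. -/
def gaussI : GaussianInt := ⟨0, 1⟩

open Classical in
/-- The quartic residue symbol `(α / π)₄` for a Gaussian prime `π` of odd norm `N π`:
it is the power `i ^ m` with `α ^ ((N π - 1) / 4) ≡ i ^ m (mod π)` if `π ∤ α`,
and it is `0` if `π ∣ α`. -/
noncomputable def quarticResidueSymbol (α π : GaussianInt) : ℂ :=
  if π ∣ α then 0
  else if π ∣ α ^ (((Zsqrtd.norm π).natAbs - 1) / 4) - 1 then 1
  else if π ∣ α ^ (((Zsqrtd.norm π).natAbs - 1) / 4) - gaussI then Complex.I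
  else if π ∣ α ^ (((Zsqrtd.norm π).natAbs - 1) / 4) + 1 then -1
  else if π ∣ α ^ (((Zsqrtd.norm π).natAbs - 1) / 4) + gaussI then -Complex.I
  else 0

/-- The quartic Jacobi symbol `(α / β)₄` for `α, β ∈ ℤ[i]` with `β` of odd norm: the product of the
quartic residue symbols `(α / π)₄` over the prime factors `π` of `β`, with multiplicity.
It is `1` if `β` is a unit. As `(α / π)₄` depends on `π` only up to a unit, the choice of the
factorization does not matter, and `(α / -β)₄ = (α / β)₄`. -/
noncomputable def quarticJacobiSymbol (α β : GaussianInt) : ℂ :=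
  ((UniqueFactorizationMonoid.factors β).map (quarticResidueSymbol α)).prod

/-- The quartic Jacobi symbol `((a + b i) / m)₄` with rational `a`, `b` and an odd integer `m`
that is prime to the denominators of `a` and `b`: for a common denominator `n`, it is
the quotient of `((n a + n b i) / m)₄` by `(n / m)₄`. -/
noncomputable def quarticJacobiSymbolRat (a b : ℚ) (m : ℤ) : ℂ :=
  quarticJacobiSymbol ⟨a.num * b.den, b.num * a.den⟩ (m : GaussianInt) /
    quarticJacobiSymbol ((a.den * b.den : ℕ) : GaussianInt) (m : GaussianInt)

/-! Put π = c + di, t = d/c in ℤ/p and e = (p - 1)/8. The homomorphism ℤ[i] → ℤ/p with i ↦ t kills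
π. From x² ≡ -2qy² (mod p) one gets x^(2e) ≡ (-q)^e 2^e y^(2e). Here x^(2e) and y^(2e) are given by
the symbols (x/π)₄ and (y/π)₄, and 2^e = t^(3e) (1 + t)^(2e) because 2 = i³(1 + i)². The
supplementary laws for 2 and 1 + i take care of the powers of 2. With y₀ the odd part of y, it
remains to relate (x/π)₄ and (y₀/π)₄ to (H/q)₄, where H = x + c + di; up to the factor i and a
rational number, H is the element in the hypothesis.

The norm of H = x + π is 2(x(x + c) + qy²). Write H = 2^j i^u (1 + i)^ε α with α of odd norm and
even imaginary part, and x + c = 2^s m with m odd. Then qy² ≡ -x(x + c) (mod α). Take quartic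
symbols modulo α and invert them by reciprocity. Now H ≡ π (mod x), H ≡ di (mod m) and H² ≡ 2(x +
c)π (mod y₀), and a rational integer has symbol 1 modulo an odd rational integer prime to it. This
gives `HasQuarticIndex.sum_two_sq_relation`; comparing the powers of 2 in x + c, d and y makes it
explicit in `HasQuarticIndex.relation_of_prime`.

Reciprocity is needed only between a Gaussian integer and a rational integer
(`HasQuarticIndex.reciprocity`). For a prime π of norm p with even imaginary part, the quartic Gauss
sum g satisfies g⁴ = p J(χ, χ)² = pπ². Computing g^l by Frobenius in characteristic l and comparing
with `HasQuarticIndex.natPrime_iff` gives the law; multiplicativity does the rest. Symbols are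
recorded as exponents of i, so all identities become congruences modulo 4. -/

/-! ### Gaussian primes of odd norm -/

open GaussianInt in
theorem GaussianInt.exists_prime_dvd_natCast {π : GaussianInt} (hπ : Prime π) :
    ∃ l : ℕ, l.Prime ∧ π ∣ (l : GaussianInt) := by
  have key : ∀ n : ℕ, n ≠ 0 → π ∣ (n : GaussianInt) →
      ∃ l : ℕ, l.Prime ∧ π ∣ (l : GaussianInt) := by
    intro n
    induction n using Nat.recOnMul with
    | zero => intro h; exact absurd rfl h
    | one => intro _ h; exact absurd (isUnit_of_dvd_one (by simpa using h)) hπ.not_isUnit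
    | prime p hp => intro _ h; exact ⟨p, hp, h⟩
    | mul a b ha hb =>
      intro h0 h
      rw [Nat.cast_mul] at h
      rcases hπ.dvd_or_dvd h with h | h
      · exact ha (left_ne_zero_of_mul h0) h
      · exact hb (right_ne_zero_of_mul h0) h
  refine key (Zsqrtd.norm π).natAbs ?_ ?_
  · simpa [Int.natAbs_eq_zero, GaussianInt.norm_eq_zero] using hπ.ne_zero
  · have : (((Zsqrtd.norm π).natAbs : ℤ) : GaussianInt) = π * star π := by
      rw [GaussianInt.abs_natCast_norm, Zsqrtd.norm_eq_mul_conj]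
    exact ⟨star π, (Int.cast_natCast _).symm.trans this⟩

/-- The Gaussian primes of odd norm are, up to units, the factors of the primes `l ≡ 1 (mod 4)`
and the primes `l ≡ 3 (mod 4)`. -/
theorem GaussianInt.exists_prime_of_odd_norm {π : GaussianInt} (hπ : Prime π)
    (ho : Odd (Zsqrtd.norm π)) :
    ∃ l : ℕ, l.Prime ∧ π ∣ (l : GaussianInt) ∧
      ((l % 4 = 1 ∧ (Zsqrtd.norm π).natAbs = l) ∨
        (l % 4 = 3 ∧ (Zsqrtd.norm π).natAbs = l ^ 2)) := by
  obtain ⟨l, hl, hd⟩ := GaussianInt.exists_prime_dvd_natCast hπ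
  have : Fact l.Prime := ⟨hl⟩
  refine ⟨l, hl, hd, ?_⟩
  have hdvd : (Zsqrtd.norm π).natAbs ∣ l ^ 2 := by
    obtain ⟨k, hk⟩ := hd
    have : Zsqrtd.norm (l : GaussianInt) = Zsqrtd.norm π * Zsqrtd.norm k := by
      rw [hk, Zsqrtd.norm_mul]
    rw [Zsqrtd.norm_natCast] at this
    have h2 := congrArg Int.natAbs this
    rw [Int.natAbs_mul, Int.natAbs_mul, Int.natAbs_natCast] at h2
    exact ⟨_, by rw [sq, h2]⟩
  have h1 : (Zsqrtd.norm π).natAbs ≠ 1 := fun h => hπ.not_isUnit (Zsqrtd.norm_eq_one_iff.1 h)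
  have hodd : Odd (Zsqrtd.norm π).natAbs := Int.natAbs_odd.2 ho
  have hl2 : l ≠ 2 := by
    rintro rfl
    obtain ⟨k, hk, hk'⟩ := (Nat.dvd_prime_pow Nat.prime_two).1 hdvd
    rcases Nat.eq_zero_or_pos k with rfl | hkpos
    · exact h1 (by simpa using hk')
    · rw [hk'] at hodd
      exact (Nat.not_even_iff_odd.2 hodd) ((Nat.even_pow.2 ⟨even_two, hkpos.ne'⟩))
  have hlo : l % 2 = 1 := hl.eq_two_or_odd.resolve_left hl2
  have hl4 : l % 4 = 1 ∨ l % 4 = 3 := by omega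
  rcases hl4 with h4 | h4
  · left
    refine ⟨h4, ?_⟩
    obtain ⟨k, hk, hk'⟩ := (Nat.dvd_prime_pow hl).1 hdvd
    interval_cases k
    · exact absurd (by simpa using hk') h1
    · simpa using hk'
    · exfalso
      obtain ⟨κ, hκ⟩ := hd
      have hn : (Zsqrtd.norm (l : GaussianInt)).natAbs =
          (Zsqrtd.norm π).natAbs * (Zsqrtd.norm κ).natAbs := by
        rw [hκ, Zsqrtd.norm_mul, Int.natAbs_mul]
      rw [Zsqrtd.norm_natCast, Int.natAbs_mul, Int.natAbs_natCast, hk'] at hn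
      have hκ1 : (Zsqrtd.norm κ).natAbs = 1 := by
        have : 0 < l ^ 2 := pow_pos hl.pos 2
        nlinarith
      have hu : IsUnit κ := Zsqrtd.norm_eq_one_iff.1 hκ1
      have hpl : Prime (l : GaussianInt) := by
        rw [hκ]
        exact (associated_mul_unit_right π κ hu).prime hπ
      have := (GaussianInt.prime_iff_mod_four_eq_three_of_nat_prime l).1 hpl
      omega
  · right
    refine ⟨h4, ?_⟩
    have hpl := GaussianInt.prime_of_nat_prime_of_mod_four_eq_three l h4
    have hass : Associated π (l : GaussianInt) := hπ.associated_of_dvd hpl hd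
    rw [Zsqrtd.norm_eq_of_associated (by norm_num) hass, Zsqrtd.norm_natCast, Int.natAbs_mul,
      Int.natAbs_natCast, sq]

/-! ### The unit i and the Frobenius map on images of ℤ[i] -/

theorem gaussI_sq : gaussI ^ 2 = -1 := by
  rw [sq]; ext <;> simp [gaussI]

theorem GaussianInt.eq_add_mul_gaussI (z : GaussianInt) :
    z = (z.re : GaussianInt) + (z.im : GaussianInt) * gaussI := by
  ext <;> simp [gaussI]

theorem GaussianInt.star_eq_sub_mul_gaussI (z : GaussianInt) :
    star z = (z.re : GaussianInt) - (z.im : GaussianInt) * gaussI := by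
  ext <;> simp [gaussI]

theorem star_gaussI : star gaussI = -gaussI := by
  ext <;> simp [gaussI]

section Frobenius

variable {R : Type*} [CommRing R] (φ : GaussianInt →+* R)

theorem map_gaussI_sq : φ gaussI ^ 2 = -1 := by
  rw [← map_pow, gaussI_sq, map_neg, map_one]

theorem map_gaussI_pow_eq (n : ℕ) : φ gaussI ^ n = φ gaussI ^ (n % 4) := by
  have h4 : φ gaussI ^ 4 = 1 := by
    rw [show 4 = 2 * 2 from rfl, pow_mul, map_gaussI_sq]; norm_num
  conv_lhs => rw [← Nat.div_add_mod n 4, pow_add, pow_mul, h4, one_pow, one_mul]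

/-- Frobenius fixes the images of rational integers, and l mod 4 decides whether it sends i to i or
to -i. Hence it acts as the identity here and as conjugation in the companion lemma. -/
theorem GaussianInt.map_pow_char_of_one (l : ℕ) [Fact l.Prime] [CharP R l] (h : l % 4 = 1)
    (z : GaussianInt) : φ z ^ l = φ z := by
  have hI : φ gaussI ^ l = φ gaussI := by rw [map_gaussI_pow_eq, h, pow_one]
  rw [GaussianInt.eq_add_mul_gaussI z, map_add, map_mul, map_intCast, map_intCast, add_pow_char,
    mul_pow, hI, ← frobenius_def (p := l), ← frobenius_def (p := l), map_intCast, map_intCast]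

theorem GaussianInt.map_pow_char_of_three (l : ℕ) [Fact l.Prime] [CharP R l] (h : l % 4 = 3)
    (z : GaussianInt) : φ z ^ l = φ (star z) := by
  have hI : φ gaussI ^ l = -φ gaussI := by
    rw [map_gaussI_pow_eq, h, pow_succ, map_gaussI_sq, neg_one_mul]
  rw [GaussianInt.star_eq_sub_mul_gaussI]
  conv_lhs => rw [GaussianInt.eq_add_mul_gaussI z]
  rw [map_add, map_mul, map_intCast, map_intCast, add_pow_char,
    mul_pow, hI, ← frobenius_def (p := l), ← frobenius_def (p := l), map_intCast, map_intCast,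
    map_sub, map_mul, map_intCast, map_intCast]
  ring

end Frobenius

/-! ### Homomorphisms from ℤ[i] to a field -/

section Field

variable {K : Type*} [Field K]

theorem isPrimitiveRoot_four_of_sq_eq_neg_one {j : K} (hj : j ^ 2 = -1) (h2 : (2 : K) ≠ 0) :
    IsPrimitiveRoot j 4 := by
  have h := IsPrimitiveRoot.iff_orderOf (ζ := j) (k := 4)
  rw [h]
  refine orderOf_eq_prime_pow (p := 2) (n := 1) ?_ ?_
  · simp only [pow_one, hj]
    intro h
    apply h2
    linear_combination -h
  · rw [show 2 ^ (1 + 1) = 2 * 2 from rfl, pow_mul, hj]; norm_num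

theorem zpow_eq_zpow_iff_of_sq_eq_neg_one {j : K} (hj : j ^ 2 = -1) (h2 : (2 : K) ≠ 0) (a b : ℤ) :
    j ^ a = j ^ b ↔ a % 4 = b % 4 := by
  have hj0 : j ≠ 0 := by rintro rfl; norm_num at hj
  have h := (isPrimitiveRoot_four_of_sq_eq_neg_one hj h2).zpow_eq_one_iff_dvd (a - b)
  rw [zpow_sub₀ hj0, div_eq_one_iff_eq (zpow_ne_zero _ hj0)] at h
  rw [h]
  push_cast
  omega

theorem Complex.I_zpow_eq_iff (a b : ℤ) : Complex.I ^ a = Complex.I ^ b ↔ a % 4 = b % 4 :=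
  zpow_eq_zpow_iff_of_sq_eq_neg_one Complex.I_sq two_ne_zero a b

theorem GaussianInt.map_ne_zero_of_isCoprime {α β : GaussianInt} (h : IsCoprime α β)
    (φ : GaussianInt →+* K) (hβ : φ β = 0) : φ α ≠ 0 := by
  obtain ⟨a, b, hab⟩ := h
  intro hα
  have := congrArg φ hab
  rw [map_add, map_mul, map_mul, hα, hβ, map_one, mul_zero, mul_zero, add_zero] at this
  exact zero_ne_one this

theorem GaussianInt.map_eq_zero_iff_dvd {π : GaussianInt} (hπ : Prime π) (φ : GaussianInt →+* K)
    (h0 : φ π = 0) (z : GaussianInt) : φ z = 0 ↔ π ∣ z := by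
  constructor
  · intro hz
    by_contra hd
    exact GaussianInt.map_ne_zero_of_isCoprime
      ((Prime.coprime_iff_not_dvd hπ).2 hd).symm φ h0 hz
  · rintro ⟨k, rfl⟩
    rw [map_mul, h0, zero_mul]

theorem GaussianInt.two_ne_zero_of_odd_norm {π : GaussianInt} (ho : Odd (Zsqrtd.norm π))
    (φ : GaussianInt →+* K) (h0 : φ π = 0) : (2 : K) ≠ 0 := by
  intro h2
  obtain ⟨k, hk⟩ := ho
  have h : φ (Zsqrtd.norm π : GaussianInt) = 0 := by
    rw [Zsqrtd.norm_eq_mul_conj, map_mul, h0, zero_mul]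
  rw [hk, map_intCast] at h
  push_cast at h
  rw [h2, zero_mul, zero_add] at h
  exact one_ne_zero h

/-- Fermat's little theorem modulo π without counting residues: the power Nπ is one Frobenius acting
trivially, or two Frobenius maps, that is, conjugation applied twice. -/
theorem GaussianInt.map_pow_norm {π : GaussianInt} (hπ : Prime π) (ho : Odd (Zsqrtd.norm π))
    (φ : GaussianInt →+* K) (h0 : φ π = 0) {α : GaussianInt} (hα : φ α ≠ 0) :
    (Zsqrtd.norm π).natAbs % 4 = 1 ∧
      φ α ^ (4 * (((Zsqrtd.norm π).natAbs - 1) / 4)) = 1 := by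
  obtain ⟨l, hl, ⟨κ, hκ⟩, h⟩ := GaussianInt.exists_prime_of_odd_norm hπ ho
  have : Fact l.Prime := ⟨hl⟩
  have : CharP K l := by
    have : (l : K) = 0 := by
      rw [← map_natCast φ, hκ, map_mul, h0, zero_mul]
    have := CharP.ringChar_of_prime_eq_zero hl this
    exact this ▸ inferInstance
  have hmod : (Zsqrtd.norm π).natAbs % 4 = 1 := by
    rcases h with ⟨h4, h⟩ | ⟨h4, h⟩
    · rw [h, h4]
    · rw [h, Nat.pow_mod, h4]
  have hF : φ α ^ (Zsqrtd.norm π).natAbs = φ α := by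
    rcases h with ⟨h4, h⟩ | ⟨h4, h⟩
    · rw [h, GaussianInt.map_pow_char_of_one φ l h4]
    · rw [h, sq, pow_mul, GaussianInt.map_pow_char_of_three φ l h4,
        GaussianInt.map_pow_char_of_three φ l h4, star_star]
  refine ⟨hmod, ?_⟩
  rw [show 4 * (((Zsqrtd.norm π).natAbs - 1) / 4) = (Zsqrtd.norm π).natAbs - 1 by omega]
  apply mul_right_cancel₀ hα
  rw [one_mul, ← pow_succ, Nat.sub_add_cancel (by omega), hF]

end Field

/-! ### The quartic residue symbol modulo a Gaussian prime -/

theorem GaussianInt.exists_field_of_prime {π : GaussianInt} (hπ : Prime π) :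
    ∃ (K : Type) (_ : Field K) (φ : GaussianInt →+* K), φ π = 0 := by
  have : (Ideal.span {π}).IsPrime := (Ideal.span_singleton_prime hπ.ne_zero).2 hπ
  refine ⟨FractionRing (GaussianInt ⧸ Ideal.span {π}), inferInstance,
    (algebraMap (GaussianInt ⧸ Ideal.span {π}) _).comp (Ideal.Quotient.mk _), ?_⟩
  rw [RingHom.comp_apply, Ideal.Quotient.eq_zero_iff_mem.2 (Ideal.mem_span_singleton_self π),
    map_zero]

/-- The residue symbol is `i ^ n`, where `α ^ ((N π - 1) / 4) ≡ i ^ n (mod π)`. -/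
theorem quarticResidueSymbol_eq_iff {K : Type*} [Field K] {π : GaussianInt} (hπ : Prime π)
    (ho : Odd (Zsqrtd.norm π)) (φ : GaussianInt →+* K) (h0 : φ π = 0) {α : GaussianInt}
    (hα : ¬ π ∣ α) (n : ℤ) :
    quarticResidueSymbol α π = Complex.I ^ n ↔
      φ α ^ (((Zsqrtd.norm π).natAbs - 1) / 4) = φ gaussI ^ n := by
  have h2 := GaussianInt.two_ne_zero_of_odd_norm ho φ h0
  have hz := GaussianInt.map_eq_zero_iff_dvd hπ φ h0
  have hα' : φ α ≠ 0 := fun h => hα ((hz α).1 h)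
  have hj := map_gaussI_sq φ
  have hj0 : φ gaussI ≠ 0 := by
    intro h; rw [h] at hj; norm_num at hj
  have hF := (GaussianInt.map_pow_norm hπ ho φ h0 hα').2
  set e := ((Zsqrtd.norm π).natAbs - 1) / 4 with he
  have key : ∃ m : ℤ, quarticResidueSymbol α π = Complex.I ^ m ∧ φ α ^ e = φ gaussI ^ m := by
    unfold quarticResidueSymbol
    rw [if_neg hα, ← he]
    split_ifs with h1 h2 h3 h4 <;> simp only [← hz, map_sub, map_add, map_pow, map_one] at *
    · exact ⟨0, by simp, by simpa [sub_eq_zero] using h1⟩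
    · exact ⟨1, by simp, by simpa [sub_eq_zero] using h2⟩
    · exact ⟨2, by simp [zpow_ofNat], by
        rw [zpow_ofNat, hj]; exact eq_neg_of_add_eq_zero_left h3⟩
    · refine ⟨3, ?_, ?_⟩
      · rw [zpow_ofNat, pow_succ, Complex.I_sq, neg_one_mul]
      · rw [zpow_ofNat, pow_succ, hj, neg_one_mul]; exact eq_neg_of_add_eq_zero_left h4
    · exfalso
      -- The product is the factorization of z⁴ - 1, so the default value of the symbol never occurs
      -- for π ∤ α.
      have : (φ α ^ e - 1) * (φ α ^ e - φ gaussI) * (φ α ^ e + 1) * (φ α ^ e + φ gaussI) = 0 := by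
        rw [mul_comm, pow_mul] at hF
        linear_combination hF + (1 - (φ α ^ e) ^ 2) * hj
      simp only [mul_eq_zero] at this
      tauto
  obtain ⟨m, hm, hm'⟩ := key
  rw [hm, hm', Complex.I_zpow_eq_iff, zpow_eq_zpow_iff_of_sq_eq_neg_one hj h2]

theorem exists_quarticResidueSymbol_eq {π : GaussianInt} (hπ : Prime π)
    (ho : Odd (Zsqrtd.norm π)) {α : GaussianInt} (hα : ¬ π ∣ α) :
    ∃ n : ℤ, quarticResidueSymbol α π = Complex.I ^ n := by
  obtain ⟨K, _, φ, h0⟩ := GaussianInt.exists_field_of_prime hπ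
  have hz := GaussianInt.map_eq_zero_iff_dvd hπ φ h0
  have hα' : φ α ≠ 0 := fun h => hα ((hz α).1 h)
  have h2 := GaussianInt.two_ne_zero_of_odd_norm ho φ h0
  have hF := (GaussianInt.map_pow_norm hπ ho φ h0 hα').2
  rw [mul_comm, pow_mul] at hF
  obtain ⟨n, -, hn⟩ := (isPrimitiveRoot_four_of_sq_eq_neg_one (map_gaussI_sq φ)
    h2).eq_pow_of_pow_eq_one hF
  exact ⟨n, (quarticResidueSymbol_eq_iff hπ ho φ h0 hα n).2 (by rw [← hn, zpow_natCast])⟩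

theorem quarticResidueSymbol_mul {π : GaussianInt} (hπ : Prime π)
    (ho : Odd (Zsqrtd.norm π)) (α β : GaussianInt) :
    quarticResidueSymbol (α * β) π = quarticResidueSymbol α π * quarticResidueSymbol β π := by
  by_cases hα : π ∣ α
  · simp [quarticResidueSymbol, hα, hα.mul_right]
  by_cases hβ : π ∣ β
  · simp [quarticResidueSymbol, hβ, hβ.mul_left]
  obtain ⟨a, ha⟩ := exists_quarticResidueSymbol_eq hπ ho hα
  obtain ⟨b, hb⟩ := exists_quarticResidueSymbol_eq hπ ho hβ
  obtain ⟨K, _, φ, h0⟩ := GaussianInt.exists_field_of_prime hπ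
  rw [ha, hb, ← zpow_add₀ Complex.I_ne_zero,
    quarticResidueSymbol_eq_iff hπ ho φ h0 (fun h => (hπ.dvd_or_dvd h).elim hα hβ)]
  have hj := map_gaussI_sq φ
  have hj0 : φ gaussI ≠ 0 := by
    intro h; rw [h] at hj; norm_num at hj
  rw [quarticResidueSymbol_eq_iff hπ ho φ h0 hα] at ha
  rw [quarticResidueSymbol_eq_iff hπ ho φ h0 hβ] at hb
  rw [map_mul, mul_pow, ha, hb, zpow_add₀ hj0]

theorem quarticResidueSymbol_congr {π : GaussianInt} (hπ : Prime π)
    (ho : Odd (Zsqrtd.norm π)) {α β : GaussianInt} (h : π ∣ α - β) :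
    quarticResidueSymbol α π = quarticResidueSymbol β π := by
  by_cases hα : π ∣ α
  · have hβ : π ∣ β := (dvd_sub_right hα).1 h
    simp [quarticResidueSymbol, hα, hβ]
  have hβ : ¬ π ∣ β := fun hβ => hα ((dvd_sub_left hβ).1 h)
  obtain ⟨a, ha⟩ := exists_quarticResidueSymbol_eq hπ ho hα
  obtain ⟨K, _, φ, h0⟩ := GaussianInt.exists_field_of_prime hπ
  rw [ha, eq_comm, quarticResidueSymbol_eq_iff hπ ho φ h0 hβ]
  rw [quarticResidueSymbol_eq_iff hπ ho φ h0 hα] at ha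
  have hab : φ α = φ β := by
    rw [← sub_eq_zero, ← map_sub]
    exact (GaussianInt.map_eq_zero_iff_dvd hπ φ h0 _).2 h
  rw [← hab, ha]

theorem quarticResidueSymbol_of_associated {π ρ : GaussianInt} (h : Associated π ρ)
    (α : GaussianInt) : quarticResidueSymbol α π = quarticResidueSymbol α ρ := by
  classical
  have hd := fun z : GaussianInt => h.dvd_iff_dvd_left (c := z)
  unfold quarticResidueSymbol
  rw [Zsqrtd.norm_eq_of_associated (by norm_num) h]
  exact if_congr (hd _) rfl (if_congr (hd _) rfl (if_congr (hd _) rfl (if_congr (hd _) rfl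
    (if_congr (hd _) rfl rfl))))

/-! ### Multiplicativity of the quartic Jacobi symbol -/

section Jacobi

open UniqueFactorizationMonoid

theorem GaussianInt.odd_norm_of_dvd {α β : GaussianInt} (h : α ∣ β) (hβ : Odd (Zsqrtd.norm β)) :
    Odd (Zsqrtd.norm α) := by
  obtain ⟨k, rfl⟩ := h
  rw [Zsqrtd.norm_mul] at hβ
  exact (Int.odd_mul.1 hβ).1

theorem GaussianInt.ne_zero_of_odd_norm {β : GaussianInt} (hβ : Odd (Zsqrtd.norm β)) : β ≠ 0 := by
  rintro rfl
  simp at hβ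

/-- `factors` is determined only up to units, so the two multisets are matched by association, which
the residue symbol ignores. -/
theorem quarticJacobiSymbol_of_associated {β γ : GaussianInt} (h : Associated β γ)
    (α : GaussianInt) : quarticJacobiSymbol α β = quarticJacobiSymbol α γ := by
  unfold quarticJacobiSymbol
  congr 1
  rw [← Multiset.rel_eq, Multiset.rel_map]
  exact (factors_rel_of_associated h).mono
    fun a _ b _ hab => quarticResidueSymbol_of_associated hab α

theorem quarticJacobiSymbol_mul_right (α : GaussianInt) {β γ : GaussianInt} (hβ : β ≠ 0)
    (hγ : γ ≠ 0) :
    quarticJacobiSymbol α (β * γ) = quarticJacobiSymbol α β * quarticJacobiSymbol α γ := by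
  unfold quarticJacobiSymbol
  rw [← Multiset.prod_add, ← Multiset.map_add]
  congr 1
  rw [← Multiset.rel_eq, Multiset.rel_map]
  exact (factors_mul hβ hγ).mono fun a _ b _ hab => quarticResidueSymbol_of_associated hab α

theorem quarticJacobiSymbol_prime (α : GaussianInt) {π : GaussianInt} (hπ : Prime π) :
    quarticJacobiSymbol α π = quarticResidueSymbol α π := by
  obtain ⟨ρ, hρ, h⟩ := factors_eq_singleton_of_irreducible hπ.irreducible
  rw [quarticJacobiSymbol, h, Multiset.map_singleton, Multiset.prod_singleton,
    quarticResidueSymbol_of_associated hρ]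

theorem quarticJacobiSymbol_isUnit (α : GaussianInt) {u : GaussianInt} (hu : IsUnit u) :
    quarticJacobiSymbol α u = 1 := by
  rw [quarticJacobiSymbol, factors_of_isUnit hu, Multiset.map_zero, Multiset.prod_zero]

theorem quarticJacobiSymbol_mul_left (α α' : GaussianInt) {β : GaussianInt}
    (hβ : Odd (Zsqrtd.norm β)) :
    quarticJacobiSymbol (α * α') β = quarticJacobiSymbol α β * quarticJacobiSymbol α' β := by
  unfold quarticJacobiSymbol
  rw [← Multiset.prod_map_mul]
  congr 1
  refine Multiset.map_congr rfl fun π hπ => ?_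
  exact quarticResidueSymbol_mul (prime_of_factor π hπ)
    (GaussianInt.odd_norm_of_dvd (dvd_of_mem_factors hπ) hβ) α α'

theorem quarticJacobiSymbol_congr {α α' β : GaussianInt} (hβ : Odd (Zsqrtd.norm β))
    (h : β ∣ α - α') : quarticJacobiSymbol α β = quarticJacobiSymbol α' β := by
  unfold quarticJacobiSymbol
  congr 1
  refine Multiset.map_congr rfl fun π hπ => ?_
  exact quarticResidueSymbol_congr (prime_of_factor π hπ)
    (GaussianInt.odd_norm_of_dvd (dvd_of_mem_factors hπ) hβ) ((dvd_of_mem_factors hπ).trans h)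

theorem exists_quarticJacobiSymbol_eq {α β : GaussianInt} (hβ : Odd (Zsqrtd.norm β))
    (h : IsCoprime α β) : ∃ n : ℤ, quarticJacobiSymbol α β = Complex.I ^ n := by
  have key : ∀ s : Multiset GaussianInt, (∀ π ∈ s, π ∈ factors β) →
      ∃ n : ℤ, (s.map (quarticResidueSymbol α)).prod = Complex.I ^ n := by
    intro s
    induction s using Multiset.induction_on with
    | empty => intro _; exact ⟨0, by simp⟩
    | cons π s ih =>
      intro hs
      obtain ⟨n, hn⟩ := ih fun ρ hρ => hs ρ (Multiset.mem_cons_of_mem hρ)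
      have hmem := hs π (Multiset.mem_cons_self π s)
      have hp := prime_of_factor π hmem
      obtain ⟨m, hm⟩ := exists_quarticResidueSymbol_eq hp
        (GaussianInt.odd_norm_of_dvd (dvd_of_mem_factors hmem) hβ)
        (α := α) (fun hd => hp.not_isUnit (h.isUnit_of_dvd' hd (dvd_of_mem_factors hmem)))
      exact ⟨m + n, by rw [Multiset.map_cons, Multiset.prod_cons, hm, hn,
        zpow_add₀ Complex.I_ne_zero]⟩
  exact key _ fun _ h => h

end Jacobi

/-! ### Calculus of exponents of i -/

/-- `n` is an index of `α` modulo `β`: the quartic Jacobi symbol `(α / β)₄` is `i ^ n`. -/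
def HasQuarticIndex (α β : GaussianInt) (n : ℤ) : Prop :=
  quarticJacobiSymbol α β = Complex.I ^ n

namespace HasQuarticIndex

variable {α α' β β' : GaussianInt} {m n : ℤ}

theorem unique (h : HasQuarticIndex α β m) (h' : HasQuarticIndex α β n) : m % 4 = n % 4 :=
  (Complex.I_zpow_eq_iff m n).1 (h.symm.trans h')

theorem of_emod_eq (h : HasQuarticIndex α β m) (hmn : m % 4 = n % 4) : HasQuarticIndex α β n :=
  Eq.trans h ((Complex.I_zpow_eq_iff m n).2 hmn)

theorem mul_left (h : HasQuarticIndex α β m) (h' : HasQuarticIndex α' β n)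
    (hβ : Odd (Zsqrtd.norm β)) : HasQuarticIndex (α * α') β (m + n) := by
  unfold HasQuarticIndex at *
  rw [quarticJacobiSymbol_mul_left α α' hβ, h, h', zpow_add₀ Complex.I_ne_zero]

theorem mul_right (h : HasQuarticIndex α β m) (h' : HasQuarticIndex α β' n)
    (hβ : Odd (Zsqrtd.norm β)) (hβ' : Odd (Zsqrtd.norm β')) :
    HasQuarticIndex α (β * β') (m + n) := by
  unfold HasQuarticIndex at *
  rw [quarticJacobiSymbol_mul_right α (GaussianInt.ne_zero_of_odd_norm hβ)
    (GaussianInt.ne_zero_of_odd_norm hβ'), h, h', zpow_add₀ Complex.I_ne_zero]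

theorem congr (h : HasQuarticIndex α β n) (hβ : Odd (Zsqrtd.norm β)) (hd : β ∣ α - α') :
    HasQuarticIndex α' β n :=
  (quarticJacobiSymbol_congr hβ hd).symm.trans h

theorem of_associated (h : HasQuarticIndex α β n) (hβ : Associated β β') :
    HasQuarticIndex α β' n :=
  (quarticJacobiSymbol_of_associated hβ α).symm.trans h

theorem exists_of_isCoprime (hβ : Odd (Zsqrtd.norm β)) (h : IsCoprime α β) :
    ∃ n, HasQuarticIndex α β n :=
  exists_quarticJacobiSymbol_eq hβ h

theorem of_isUnit (hβ : IsUnit β) : HasQuarticIndex α β 0 := by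
  rw [HasQuarticIndex, quarticJacobiSymbol_isUnit α hβ, zpow_zero]

theorem pow_left (h : HasQuarticIndex α β n) (hβ : Odd (Zsqrtd.norm β)) (k : ℕ) :
    HasQuarticIndex (α ^ k) β (k * n) := by
  induction k with
  | zero =>
    have h1 : HasQuarticIndex 1 β 0 := by
      unfold HasQuarticIndex quarticJacobiSymbol
      rw [Multiset.prod_eq_one, zpow_zero]
      intro z hz
      obtain ⟨π, hπ, rfl⟩ := Multiset.mem_map.1 hz
      have hp := UniqueFactorizationMonoid.prime_of_factor π hπ
      have hnd : ¬ π ∣ 1 := fun h => hp.not_isUnit (isUnit_of_dvd_one h)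
      simp [quarticResidueSymbol, hnd]
    simpa using h1
  | succ k ih =>
    rw [pow_succ]
    exact (ih.mul_left h hβ).of_emod_eq (by push_cast; ring_nf)

theorem prime_iff {K : Type*} [Field K] {π : GaussianInt} (hπ : Prime π)
    (ho : Odd (Zsqrtd.norm π)) (φ : GaussianInt →+* K) (h0 : φ π = 0) (hα : φ α ≠ 0) :
    HasQuarticIndex α π n ↔
      φ α ^ (((Zsqrtd.norm π).natAbs - 1) / 4) = φ gaussI ^ n := by
  rw [HasQuarticIndex, quarticJacobiSymbol_prime α hπ,
    quarticResidueSymbol_eq_iff hπ ho φ h0]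
  exact fun h => hα ((GaussianInt.map_eq_zero_iff_dvd hπ φ h0 α).2 h)

end HasQuarticIndex

/-! ### Sign normalization of odd integers -/

/-- The number `±m` that is `1` modulo `4`, for odd `m`. -/
def Int.primarySign (m : ℤ) : ℤ := if m % 4 = 1 then m else -m

theorem Int.primarySign_emod_four {m : ℤ} (hm : Odd m) : m.primarySign % 4 = 1 := by
  obtain ⟨k, rfl⟩ := hm
  unfold Int.primarySign
  split_ifs <;> omega

theorem Int.primarySign_mul {m n : ℤ} (hm : Odd m) (hn : Odd n) :
    (m * n).primarySign = m.primarySign * n.primarySign := by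
  have h : ∀ k : ℤ, Odd k → k % 4 = 1 ∨ k % 4 = 3 := by
    rintro k ⟨j, rfl⟩; omega
  unfold Int.primarySign
  rw [Int.mul_emod]
  rcases h m hm with hm | hm <;> rcases h n hn with hn | hn <;> simp [hm, hn]

theorem Int.primarySign_eq_or (m : ℤ) : m.primarySign = m ∨ m.primarySign = -m := by
  unfold Int.primarySign
  split_ifs <;> simp

/-- The number `k` with `±m = 1 + 4 k`, for odd `m`. -/
def Int.primaryQuarter (m : ℤ) : ℤ := (m.primarySign - 1) / 4

theorem Int.primarySign_eq {m : ℤ} (hm : Odd m) : m.primarySign = 1 + 4 * m.primaryQuarter := by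
  have := Int.primarySign_emod_four hm
  unfold Int.primaryQuarter
  omega

theorem Int.primaryQuarter_mul {m n : ℤ} (hm : Odd m) (hn : Odd n) :
    (m * n).primaryQuarter % 4 = (m.primaryQuarter + n.primaryQuarter) % 4 := by
  have h := Int.primarySign_eq (hm.mul hn)
  rw [Int.primarySign_mul hm hn, Int.primarySign_eq hm, Int.primarySign_eq hn] at h
  have : (m * n).primaryQuarter =
      m.primaryQuarter + n.primaryQuarter + 4 * (m.primaryQuarter * n.primaryQuarter) := by
    linarith
  omega

/-! ### Symbols modulo a rational integer -/

theorem GaussianInt.odd_norm_intCast {m : ℤ} (hm : Odd m) :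
    Odd (Zsqrtd.norm (m : GaussianInt)) := by
  rw [Zsqrtd.norm_intCast]; exact hm.mul hm

theorem GaussianInt.isCoprime_star {α : GaussianInt} {m : ℤ} (h : IsCoprime α (m : GaussianInt)) :
    IsCoprime (star α) (m : GaussianInt) := by
  have := h.map (starRingEnd GaussianInt)
  rw [map_intCast] at this
  exact this

theorem GaussianInt.isCoprime_intCast {a b : ℤ} (h : IsCoprime a b) :
    IsCoprime (a : GaussianInt) (b : GaussianInt) := by
  exact h.map (Int.castRingHom GaussianInt)

theorem map_gaussI_ne_zero {K : Type*} [Field K] (φ : GaussianInt →+* K) : φ gaussI ≠ 0 := by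
  intro h
  have := map_gaussI_sq φ
  rw [h] at this
  norm_num at this

theorem GaussianInt.prime_of_norm_eq_prime {l : ℕ} (hl : l.Prime) {π : GaussianInt}
    (hπ : Zsqrtd.norm π = l) : Prime π := by
  rw [← irreducible_iff_prime]
  refine ⟨fun hu => ?_, fun x y hxy => ?_⟩
  · rw [← Zsqrtd.norm_eq_one_iff, hπ] at hu
    exact hl.one_lt.ne' (by simpa using hu)
  · have : (Zsqrtd.norm x).natAbs * (Zsqrtd.norm y).natAbs = l := by
      rw [← Int.natAbs_mul, ← Zsqrtd.norm_mul, ← hxy, hπ, Int.natAbs_natCast]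
    rw [← Zsqrtd.norm_eq_one_iff, ← Zsqrtd.norm_eq_one_iff]
    rcases (Nat.dvd_prime hl).1 ⟨_, this.symm⟩ with h | h
    · exact Or.inl h
    · right
      rw [h] at this
      exact Nat.eq_of_mul_eq_mul_left hl.pos (by rw [this, mul_one])

/-- A sum of two squares splits l; of the two conjugate factors one is chosen that φ kills. -/
theorem GaussianInt.exists_prime_mul_star {K : Type*} [Field K] (φ : GaussianInt →+* K) {l : ℕ}
    [hl : Fact l.Prime] [CharP K l] (h : l % 4 = 1) :
    ∃ π : GaussianInt, Prime π ∧ φ π = 0 ∧ Zsqrtd.norm π = l ∧ π * star π = (l : ℤ) := by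
  have hn : ¬ Prime (l : GaussianInt) := by
    rw [GaussianInt.prime_iff_mod_four_eq_three_of_nat_prime]; omega
  obtain ⟨a, b, hab⟩ := Nat.Prime.sq_add_sq (p := l) (by omega)
  have key : ∀ π : GaussianInt, Zsqrtd.norm π = l → φ π = 0 →
      Prime π ∧ φ π = 0 ∧ Zsqrtd.norm π = l ∧ π * star π = (l : ℤ) := fun π hπ h0 =>
    ⟨GaussianInt.prime_of_norm_eq_prime hl.out hπ, h0, hπ, by rw [← Zsqrtd.norm_eq_mul_conj, hπ]⟩
  have hnorm : Zsqrtd.norm (⟨a, b⟩ : GaussianInt) = l := by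
    rw [Zsqrtd.norm_def, ← hab]; push_cast; ring
  have hmul : φ ⟨a, b⟩ * φ (star ⟨a, b⟩) = 0 := by
    rw [← map_mul, ← Zsqrtd.norm_eq_mul_conj, hnorm]; simp
  rcases mul_eq_zero.1 hmul with h0 | h0
  · exact ⟨_, key _ hnorm h0⟩
  · exact ⟨_, key _ (by rw [Zsqrtd.norm_conj, hnorm]) h0⟩

/-- The criterion is applied to φ composed with conjugation, which kills the conjugate prime;
conjugation inverts i, whence the sign of the exponent. -/
theorem quarticResidueSymbol_exists_star {π : GaussianInt} (hπ : Prime π)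
    (ho : Odd (Zsqrtd.norm π)) {α : GaussianInt} (hα : ¬ star π ∣ α) {K : Type*} [Field K]
    (φ : GaussianInt →+* K) (h0 : φ π = 0) {n : ℤ}
    (h : quarticResidueSymbol α (star π) = Complex.I ^ n) :
    φ (star α) ^ (((Zsqrtd.norm π).natAbs - 1) / 4) = φ gaussI ^ (-n) := by
  have hπ' : Prime (star π) := by
    have := (MulEquiv.prime_iff (starMulAut (R := GaussianInt))).2 hπ
    exact this
  have h0' : (φ.comp (starRingEnd GaussianInt)) (star π) = 0 := by
    simp [starRingEnd_apply, h0]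
  rw [quarticResidueSymbol_eq_iff hπ' (by rwa [Zsqrtd.norm_conj]) _ h0' hα] at h
  simp only [Zsqrtd.norm_conj, RingHom.comp_apply, starRingEnd_apply, star_gaussI, map_neg] at h
  rw [h]
  have hj := map_gaussI_sq φ
  have : -φ gaussI = (φ gaussI)⁻¹ := by
    apply eq_inv_of_mul_eq_one_left
    linear_combination -hj
  rw [this, inv_zpow, zpow_neg]

/-- In characteristic `l`, the symbol `(α / l)₄` is a power of the quotient of `α` by its
conjugate. -/
theorem HasQuarticIndex.natPrime_iff {K : Type*} [Field K] (φ : GaussianInt →+* K) {l : ℕ}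
    [hl : Fact l.Prime] [CharP K l] (hlo : Odd (l : ℤ)) {α : GaussianInt}
    (hα : IsCoprime α ((l : ℤ) : GaussianInt)) {n : ℤ} :
    HasQuarticIndex α ((l : ℤ) : GaussianInt) n ↔
      (φ α / φ (star α)) ^ (l : ℤ).primaryQuarter = φ gaussI ^ n := by
  have hl0 : φ ((l : ℤ) : GaussianInt) = 0 := by simp
  have hφ := GaussianInt.map_ne_zero_of_isCoprime hα φ hl0
  have hφ' := GaussianInt.map_ne_zero_of_isCoprime (GaussianInt.isCoprime_star hα) φ hl0
  have hI := map_gaussI_ne_zero φ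
  have h2 : (2 : K) ≠ 0 := by
    have : ((2 : ℕ) : K) ≠ 0 := by
      rw [Ne, CharP.cast_eq_zero_iff K l, Nat.prime_dvd_prime_iff_eq hl.out Nat.prime_two]
      rintro rfl
      revert hlo; decide
    exact_mod_cast this
  have key : ∀ m, HasQuarticIndex α ((l : ℤ) : GaussianInt) m →
      (φ α / φ (star α)) ^ (l : ℤ).primaryQuarter = φ gaussI ^ m := by
    intro m hm
    have h4 : l % 4 = 1 ∨ l % 4 = 3 := by
      obtain ⟨k, hk⟩ := hlo; omega
    rcases h4 with h4 | h4
    · obtain ⟨π, hπ, h0, hn, hmul⟩ := GaussianInt.exists_prime_mul_star φ h4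
      have ho : Odd (Zsqrtd.norm π) := by rw [hn]; exact hlo
      have hπ' : Prime (star π) := (MulEquiv.prime_iff (starMulAut (R := GaussianInt))).2 hπ
      have ho' : Odd (Zsqrtd.norm (star π)) := by rwa [Zsqrtd.norm_conj]
      have hd : ¬ π ∣ α := fun hd => hπ.not_isUnit
        (hα.isUnit_of_dvd' hd (hmul ▸ dvd_mul_right _ _))
      have hd' : ¬ star π ∣ α := fun hd => hπ'.not_isUnit
        (hα.isUnit_of_dvd' hd (hmul ▸ dvd_mul_left _ _))
      obtain ⟨a, ha⟩ := exists_quarticResidueSymbol_eq hπ ho hd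
      obtain ⟨b, hb⟩ := exists_quarticResidueSymbol_eq hπ' ho' hd'
      have hab : a + b = m ∨ (a + b) % 4 = m % 4 := by
        right
        refine HasQuarticIndex.unique ?_ hm
        rw [← hmul]
        refine HasQuarticIndex.mul_right ?_ ?_ ho ho'
        · rwa [HasQuarticIndex, quarticJacobiSymbol_prime α hπ]
        · rwa [HasQuarticIndex, quarticJacobiSymbol_prime α hπ']
      -- Both symbols, modulo π and modulo its conjugate, are now read off in the same field K;
      -- their product is the power of the quotient of φ(α) by the image of the conjugate.
      have ha' := (quarticResidueSymbol_eq_iff hπ ho φ h0 hd a).1 ha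
      have hb' := quarticResidueSymbol_exists_star hπ ho hd' φ h0 hb
      have hq : (l : ℤ).primaryQuarter = (((l - 1) / 4 : ℕ) : ℤ) := by
        unfold Int.primaryQuarter Int.primarySign
        rw [if_pos (by omega)]; omega
      rw [hn, Int.natAbs_natCast] at ha' hb'
      rw [hq, zpow_natCast, div_pow, ha', hb', ← zpow_sub₀ hI,
        zpow_eq_zpow_iff_of_sq_eq_neg_one (map_gaussI_sq φ) h2]
      omega
    · have hπ : Prime ((l : ℤ) : GaussianInt) := by
        rw [Int.cast_natCast]
        exact GaussianInt.prime_of_nat_prime_of_mod_four_eq_three l h4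
      have h := (HasQuarticIndex.prime_iff hπ (GaussianInt.odd_norm_intCast hlo) φ hl0 hφ).1 hm
      have hq : (l : ℤ).primaryQuarter = -(((l + 1) / 4 : ℕ) : ℤ) := by
        unfold Int.primaryQuarter Int.primarySign
        rw [if_neg (by omega)]; omega
      obtain ⟨k, rfl⟩ : ∃ k, l = 4 * k + 3 := ⟨l / 4, by omega⟩
      -- With l = 4k + 3 this is (l² - 1)/4 + (l + 1)/4 = l(l + 1)/4; the l-th power is conjugation.
      have he : ((Zsqrtd.norm (((4 * k + 3 : ℕ) : ℤ) : GaussianInt)).natAbs - 1) / 4 + (k + 1) =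
          (4 * k + 3) * (k + 1) := by
        rw [Zsqrtd.norm_intCast, Int.natAbs_mul, Int.natAbs_natCast]
        have : (4 * k + 3) * (4 * k + 3) = 4 * (4 * k * k + 6 * k + 2) + 1 := by ring
        rw [this, Nat.add_sub_cancel, Nat.mul_div_cancel_left _ (by norm_num)]
        ring
      rw [hq, show (4 * k + 3 + 1) / 4 = k + 1 by omega, ← h, zpow_neg, zpow_natCast, div_pow,
        inv_div, div_eq_iff (pow_ne_zero _ hφ), ← pow_add, he, pow_mul,
        GaussianInt.map_pow_char_of_three φ _ h4]
  refine ⟨key n, fun h => ?_⟩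
  obtain ⟨m, hm⟩ := HasQuarticIndex.exists_of_isCoprime (GaussianInt.odd_norm_intCast hlo) hα
  refine hm.of_emod_eq ?_
  rw [← zpow_eq_zpow_iff_of_sq_eq_neg_one (map_gaussI_sq φ) h2, ← key m hm, h]

theorem GaussianInt.nonempty_ringHom_algebraicClosure (l : ℕ) [Fact l.Prime] :
    Nonempty (GaussianInt →+* AlgebraicClosure (ZMod l)) := by
  obtain ⟨j, hj⟩ := IsAlgClosed.exists_pow_nat_eq (-1 : AlgebraicClosure (ZMod l)) two_pos
  exact ⟨Zsqrtd.lift ⟨j, by rw [← sq, hj]; norm_num⟩⟩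

/-- Induction on odd integers that are divisors of a given odd integer. -/
theorem Int.odd_induction {P : ℤ → Prop} (h1 : P 1) (hneg : ∀ m, Odd m → P m → P (-m))
    (hp : ∀ l : ℕ, l.Prime → Odd (l : ℤ) → P l)
    (hmul : ∀ a b, Odd a → Odd b → P a → P b → P (a * b)) (m : ℤ) (hm : Odd m) : P m := by
  have key : ∀ n : ℕ, Odd (n : ℤ) → P n := by
    intro n
    induction n using Nat.recOnMul with
    | zero => intro h; simp at h
    | one => intro _; simpa using h1
    | prime p hp' => exact hp p hp'
    | mul a b ha hb =>
      intro h
      rw [Nat.cast_mul] at h ⊢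
      obtain ⟨h1, h2⟩ := Int.odd_mul.1 h
      exact hmul _ _ h1 h2 (ha h1) (hb h2)
  rcases Int.natAbs_eq m with h | h
  · rw [h]; exact key _ (h ▸ hm)
  · rw [h]
    have : Odd (m.natAbs : ℤ) := (Int.odd_coe_nat _).2 (Int.natAbs_odd.2 hm)
    exact hneg _ this (key _ this)

theorem associated_intCast_neg (m : ℤ) :
    Associated (m : GaussianInt) ((-m : ℤ) : GaussianInt) := by
  rw [Int.cast_neg]
  exact (Associated.refl _).neg_right

theorem HasQuarticIndex.neg_right {α : GaussianInt} {m n : ℤ} (h : HasQuarticIndex α m n) :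
    HasQuarticIndex α ((-m : ℤ) : GaussianInt) n :=
  h.of_associated (associated_intCast_neg m)

theorem IsCoprime.gaussianInt_of_mul_right_left {α : GaussianInt} {a b : ℤ}
    (h : IsCoprime α ((a * b : ℤ) : GaussianInt)) : IsCoprime α (a : GaussianInt) := by
  rw [Int.cast_mul] at h; exact h.of_mul_right_left

theorem IsCoprime.gaussianInt_of_mul_right_right {α : GaussianInt} {a b : ℤ}
    (h : IsCoprime α ((a * b : ℤ) : GaussianInt)) : IsCoprime α (b : GaussianInt) := by
  rw [Int.cast_mul] at h; exact h.of_mul_right_right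

theorem HasQuarticIndex.intCast_mul_right {α : GaussianInt} {a b m n k : ℤ} (ha : Odd a)
    (hb : Odd b) (h : HasQuarticIndex α a m) (h' : HasQuarticIndex α b n)
    (hk : (m + n) % 4 = k % 4) : HasQuarticIndex α ((a * b : ℤ) : GaussianInt) k := by
  rw [Int.cast_mul]
  exact (h.mul_right h' (GaussianInt.odd_norm_intCast ha)
    (GaussianInt.odd_norm_intCast hb)).of_emod_eq hk

/-- A rational integer is a quartic residue modulo each rational integer prime to it. -/
theorem HasQuarticIndex.intCast {a m : ℤ} (hm : Odd m) (h : IsCoprime a m) :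
    HasQuarticIndex (a : GaussianInt) (m : GaussianInt) 0 := by
  replace h := GaussianInt.isCoprime_intCast h
  revert h
  refine Int.odd_induction (P := fun m => IsCoprime (a : GaussianInt) (m : GaussianInt) →
    HasQuarticIndex (a : GaussianInt) (m : GaussianInt) 0) ?_ ?_ ?_ ?_ m hm
  · intro _; exact HasQuarticIndex.of_isUnit (by simp)
  · intro m _ ih h
    exact (ih (h.of_isCoprime_of_dvd_right (associated_intCast_neg m).dvd)).neg_right
  · intro l hl hlo h
    have : Fact l.Prime := ⟨hl⟩
    obtain ⟨φ⟩ := GaussianInt.nonempty_ringHom_algebraicClosure l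
    have h0 := GaussianInt.map_ne_zero_of_isCoprime h φ (by simp)
    rw [HasQuarticIndex.natPrime_iff φ hlo h]
    have hs : star (a : GaussianInt) = a := by simp
    rw [hs, div_self h0, one_zpow, zpow_zero]
  · intro a b ha hb iha ihb h
    exact (iha h.gaussianInt_of_mul_right_left).intCast_mul_right ha hb
      (ihb h.gaussianInt_of_mul_right_right) rfl

theorem isCoprime_of_isUnit_left {R : Type*} [CommSemiring R] {u x : R} (hu : IsUnit u) :
    IsCoprime u x := by
  obtain ⟨v, hv⟩ := hu.exists_left_inv
  exact ⟨v, 0, by rw [hv, zero_mul, add_zero]⟩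

theorem isCoprime_one_add_gaussI {m : ℤ} (hm : Odd m) :
    IsCoprime (1 + gaussI) (m : GaussianInt) := by
  obtain ⟨k, rfl⟩ := hm
  refine ⟨-(k : GaussianInt) * (1 - gaussI), 1, ?_⟩
  have := gaussI_sq
  push_cast
  linear_combination (k : GaussianInt) * this

/-- The supplementary law for `1 + i` modulo a rational integer. -/
theorem HasQuarticIndex.one_add_gaussI {m : ℤ} (hm : Odd m) :
    HasQuarticIndex (1 + gaussI) (m : GaussianInt) m.primaryQuarter := by
  refine Int.odd_induction (P := fun m =>
    HasQuarticIndex (1 + gaussI) (m : GaussianInt) m.primaryQuarter) ?_ ?_ ?_ ?_ m hm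
  · exact HasQuarticIndex.of_isUnit (by simp)
  · intro m hm ih
    have : (-m).primaryQuarter = m.primaryQuarter := by
      unfold Int.primaryQuarter Int.primarySign
      obtain ⟨k, rfl⟩ := hm
      congr 2
      split_ifs <;> omega
    rw [this]
    exact ih.neg_right
  · intro l hl hlo
    have : Fact l.Prime := ⟨hl⟩
    obtain ⟨φ⟩ := GaussianInt.nonempty_ringHom_algebraicClosure l
    have hc := isCoprime_one_add_gaussI hlo
    have h0 := GaussianInt.map_ne_zero_of_isCoprime (GaussianInt.isCoprime_star hc) φ (by simp)
    rw [HasQuarticIndex.natPrime_iff φ hlo hc]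
    congr 1
    -- The quotient of 1 + i by its conjugate is i.
    rw [div_eq_iff h0]
    have hj := map_gaussI_sq φ
    simp only [star_add, star_one, star_gaussI, map_add, map_one, map_neg]
    linear_combination hj
  · intro a b ha hb iha ihb
    exact iha.intCast_mul_right ha hb ihb (Int.primaryQuarter_mul ha hb).symm

theorem isUnit_gaussI : IsUnit gaussI :=
  IsUnit.of_mul_eq_one (-gaussI) (by have := gaussI_sq; linear_combination -this)

/-- The supplementary law for `i` modulo a rational integer. -/
theorem HasQuarticIndex.gaussI_intCast {m : ℤ} (hm : Odd m) :
    HasQuarticIndex gaussI (m : GaussianInt) (2 * m.primaryQuarter) := by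
  have ho := GaussianInt.odd_norm_intCast hm
  have h2 : HasQuarticIndex ((2 : ℤ) : GaussianInt) (m : GaussianInt) 0 :=
    HasQuarticIndex.intCast hm (by
      obtain ⟨k, rfl⟩ := hm
      exact ⟨-k, 1, by ring⟩)
  obtain ⟨n, hn⟩ := HasQuarticIndex.exists_of_isCoprime ho
    (isCoprime_of_isUnit_left isUnit_gaussI)
  -- Since (1 + i)² = 2i and 2 has symbol 1, the symbol of i is the square of that of 1 + i.
  have h := (HasQuarticIndex.one_add_gaussI hm).mul_left (HasQuarticIndex.one_add_gaussI hm) ho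
  rw [show (1 + gaussI) * (1 + gaussI) = ((2 : ℤ) : GaussianInt) * gaussI by
    have := gaussI_sq
    push_cast; linear_combination this] at h
  have := (h2.mul_left hn ho).unique h
  exact hn.of_emod_eq (by omega)

/-! ### Quartic characters modulo p, their Jacobi and Gauss sums -/

section Character

variable {p : ℕ} [Fact p.Prime]

theorem gaussI_pow_four : gaussI ^ 4 = 1 := by
  rw [show 4 = 2 * 2 from rfl, pow_mul, gaussI_sq]; norm_num

theorem gaussI_mul_star : gaussI * star gaussI = 1 := by
  rw [star_gaussI]; have := gaussI_sq; linear_combination -this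

/-- The value of the quartic residue character of `ZMod p` attached to `ρ : ℤ[i] → ZMod p`. -/
theorem exists_quarticCharacter_value (ρ : GaussianInt →+* ZMod p) (hp : p % 4 = 1) (a : ZMod p) :
    ∃ u : GaussianInt, (u = 0 ∨ ∃ k : ℕ, u = gaussI ^ k) ∧ ρ u = a ^ ((p - 1) / 4) := by
  by_cases ha : a = 0
  · have : (p - 1) / 4 ≠ 0 := by
      have := (Fact.out : p.Prime).two_le; omega
    exact ⟨0, Or.inl rfl, by rw [ha, zero_pow this, map_zero]⟩
  · have h2 : (2 : ZMod p) ≠ 0 := by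
      have : ((2 : ℕ) : ZMod p) ≠ 0 := by
        rw [Ne, CharP.cast_eq_zero_iff (ZMod p) p,
          Nat.prime_dvd_prime_iff_eq Fact.out Nat.prime_two]
        rintro rfl; omega
      exact_mod_cast this
    have h1 : (a ^ ((p - 1) / 4)) ^ 4 = 1 := by
      rw [← pow_mul, show (p - 1) / 4 * 4 = p - 1 by omega, ZMod.pow_card_sub_one_eq_one ha]
    obtain ⟨k, -, hk⟩ := (isPrimitiveRoot_four_of_sq_eq_neg_one (map_gaussI_sq ρ)
      h2).eq_pow_of_pow_eq_one h1
    exact ⟨gaussI ^ k, Or.inr ⟨k, rfl⟩, by rw [map_pow, hk]⟩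

/-- The values 0 and i^k stay distinct outside characteristic 2. So identities between character
values can be checked in ℤ/p and carried to characteristic l. -/
theorem gaussI_pow_eq_of_map_eq {K : Type*} [Field K] (φ : GaussianInt →+* K) (h2 : (2 : K) ≠ 0)
    {u v : GaussianInt} (hu : u = 0 ∨ ∃ k : ℕ, u = gaussI ^ k)
    (hv : v = 0 ∨ ∃ k : ℕ, v = gaussI ^ k) (h : φ u = φ v) : u = v := by
  have h0 : ∀ k : ℕ, φ (gaussI ^ k) ≠ 0 := fun k => by
    rw [map_pow]; exact pow_ne_zero _ (map_gaussI_ne_zero φ)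
  rcases hu with rfl | ⟨a, rfl⟩ <;> rcases hv with rfl | ⟨b, rfl⟩
  · rfl
  · rw [map_zero] at h; exact absurd h.symm (h0 b)
  · rw [map_zero] at h; exact absurd h (h0 a)
  · rw [map_pow, map_pow, ← zpow_natCast, ← zpow_natCast,
      zpow_eq_zpow_iff_of_sq_eq_neg_one (map_gaussI_sq φ) h2] at h
    have ha := map_gaussI_pow_eq (RingHom.id _) a
    have hb := map_gaussI_pow_eq (RingHom.id _) b
    simp only [RingHom.id_apply] at ha hb
    rw [ha, hb]
    congr 1
    omega

/-- The quartic residue character attached to a homomorphism `ℤ[i] → ZMod p`. -/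
theorem exists_quarticCharacter (ρ : GaussianInt →+* ZMod p) (hp : p % 4 = 1) :
    ∃ χ : MulChar (ZMod p) GaussianInt, ∀ a,
      (χ a = 0 ∨ ∃ k : ℕ, χ a = gaussI ^ k) ∧ ρ (χ a) = a ^ ((p - 1) / 4) := by
  choose f hf hf' using exists_quarticCharacter_value ρ hp
  have h2 : (2 : ZMod p) ≠ 0 := by
    have : ((2 : ℕ) : ZMod p) ≠ 0 := by
      rw [Ne, CharP.cast_eq_zero_iff (ZMod p) p,
        Nat.prime_dvd_prime_iff_eq Fact.out Nat.prime_two]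
      rintro rfl; omega
    exact_mod_cast this
  have h0 : (p - 1) / 4 ≠ 0 := by
    have := (Fact.out : p.Prime).two_le; omega
  refine ⟨{ toFun := f, map_one' := ?_, map_mul' := ?_, map_nonunit' := ?_ },
    fun a => ⟨hf a, hf' a⟩⟩
  · exact gaussI_pow_eq_of_map_eq ρ h2 (hf 1) (Or.inr ⟨0, by simp⟩) (by rw [hf', map_one, one_pow])
  · intro a b
    refine gaussI_pow_eq_of_map_eq ρ h2 (hf _) ?_ (by rw [map_mul, hf', hf', hf', mul_pow])
    rcases hf a with ha | ⟨k, ha⟩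
    · left; rw [ha, zero_mul]
    · rcases hf b with hb | ⟨m, hb⟩
      · left; rw [hb, mul_zero]
      · right; exact ⟨k + m, by rw [ha, hb, pow_add]⟩
  · intro a ha
    have ha0 : a = 0 := by simpa using ha
    refine gaussI_pow_eq_of_map_eq ρ h2 (hf _) (Or.inl rfl) ?_
    rw [hf', ha0, zero_pow h0, map_zero]

/-- The summand is a polynomial in a of degree below p - 1, and such power sums vanish. -/
theorem ZMod.sum_pow_mul_one_sub_pow {f : ℕ} (hf : 2 * f < p - 1) :
    ∑ a : ZMod p, a ^ f * (1 - a) ^ f = 0 := by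
  have h : ∀ a : ZMod p, a ^ f * (1 - a) ^ f =
      ∑ k ∈ Finset.range (f + 1), ((-1) ^ k * (f.choose k : ZMod p)) * a ^ (f + k) := by
    intro a
    rw [show 1 - a = -a + 1 by ring, add_pow, Finset.mul_sum]
    refine Finset.sum_congr rfl fun k _ => ?_
    rw [neg_pow, one_pow, pow_add]; ring
  simp_rw [h]
  rw [Finset.sum_comm]
  refine Finset.sum_eq_zero fun k hk => ?_
  rw [← Finset.mul_sum, FiniteField.sum_pow_lt_card_sub_one, mul_zero]
  rw [ZMod.card]
  have := Finset.mem_range.1 hk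
  omega

variable {ρ : GaussianInt →+* ZMod p} {χ : MulChar (ZMod p) GaussianInt}

section

variable (hp : p % 4 = 1) (hχ : ∀ a, (χ a = 0 ∨ ∃ k : ℕ, χ a = gaussI ^ k) ∧
  ρ (χ a) = a ^ ((p - 1) / 4))
include hχ

theorem quarticCharacter_apply_unit (a : (ZMod p)ˣ) : ∃ k : ℕ, χ a = gaussI ^ k := by
  rcases (hχ a).1 with h | h
  · have := a.isUnit.map χ
    rw [h] at this
    exact absurd this not_isUnit_zero
  · exact h

theorem quarticCharacter_pow_four : χ ^ 4 = 1 := by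
  ext1 a
  obtain ⟨k, hk⟩ := quarticCharacter_apply_unit hχ a
  rw [MulChar.pow_apply_coe, hk, MulChar.one_apply_coe, ← pow_mul, mul_comm, pow_mul,
    gaussI_pow_four, one_pow]

theorem quarticCharacter_inv : χ⁻¹ = χ.ringHomComp (starRingEnd GaussianInt) := by
  symm
  apply eq_inv_of_mul_eq_one_right
  ext1 a
  obtain ⟨k, hk⟩ := quarticCharacter_apply_unit hχ a
  rw [MulChar.mul_apply, MulChar.ringHomComp_apply, hk, MulChar.one_apply_coe, starRingEnd_apply,
    star_pow, ← mul_pow, gaussI_mul_star, one_pow]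

include hp

theorem quarticCharacter_mul_self_ne_one : χ * χ ≠ 1 := by
  intro h
  have hc : ringChar (ZMod p) ≠ 2 := by
    rw [ZMod.ringChar_zmod_n]; rintro rfl; omega
  obtain ⟨a, ha⟩ := FiniteField.exists_nonsquare hc
  have ha0 : a ≠ 0 := by rintro rfl; exact ha (IsSquare.zero)
  rw [ZMod.euler_criterion p ha0] at ha
  apply ha
  have h1 : (χ * χ) a = 1 := by
    rw [h, MulChar.one_apply (isUnit_iff_ne_zero.2 ha0)]
  have h2 := congrArg ρ h1
  rw [MulChar.mul_apply, map_mul, (hχ a).2, map_one, ← pow_add] at h2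
  rw [← h2]
  congr 1
  omega

theorem quarticCharacter_ne_one : χ ≠ 1 := by
  rintro rfl
  exact quarticCharacter_mul_self_ne_one hp hχ (one_mul 1)

/-- Under ρ the Jacobi sum becomes a power sum of degree (p - 1)/2; hence the prime killed by ρ, and
not its conjugate, divides it. -/
theorem map_jacobiSum_quarticCharacter : ρ (jacobiSum χ χ) = 0 := by
  rw [jacobiSum, map_sum]
  simp_rw [map_mul, (hχ _).2]
  refine ZMod.sum_pow_mul_one_sub_pow ?_
  have := (Fact.out : p.Prime).two_le
  omega

/-- Over ℂ, J(χ, χ) J(χ⁻¹, χ⁻¹) = p for χ, χ² nontrivial, and the second factor is the conjugate of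
the first. -/
theorem norm_jacobiSum_quarticCharacter : Zsqrtd.norm (jacobiSum χ χ) = p := by
  have hinj := GaussianInt.toComplex_injective
  have h := jacobiSum_mul_jacobiSum_inv (F := ZMod p) (F' := ℂ)
    (χ := χ.ringHomComp GaussianInt.toComplex) (φ := χ.ringHomComp GaussianInt.toComplex)
    (by
      rw [ringChar.eq_zero, ZMod.ringChar_zmod_n]
      exact (Fact.out : p.Prime).ne_zero.symm)
    ((MulChar.ringHomComp_ne_one_iff hinj).2 (quarticCharacter_ne_one hp hχ))
    ((MulChar.ringHomComp_ne_one_iff hinj).2 (quarticCharacter_ne_one hp hχ))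
    (by
      rw [← MulChar.ringHomComp_mul]
      exact (MulChar.ringHomComp_ne_one_iff hinj).2 (quarticCharacter_mul_self_ne_one hp hχ))
  rw [MulChar.ringHomComp_inv, quarticCharacter_inv hχ, jacobiSum_ringHomComp,
    jacobiSum_ringHomComp, jacobiSum_ringHomComp, starRingEnd_apply, ← map_mul,
    ← Zsqrtd.norm_eq_mul_conj, map_intCast, ZMod.card] at h
  exact_mod_cast h

/-- The Jacobi sum is -1 modulo (i - 1)² = -2i. -/
theorem jacobiSum_quarticCharacter_im_even : Even (jacobiSum χ χ).im := by
  have hI : IsPrimitiveRoot gaussI 4 := by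
    refine IsPrimitiveRoot.iff_orderOf.2 (orderOf_eq_prime_pow (p := 2) (n := 1) ?_ gaussI_pow_four)
    rw [pow_one, gaussI_sq]
    decide
  have hdvd : 4 ∣ Fintype.card (ZMod p) - 1 := by rw [ZMod.card]; omega
  have h := exists_jacobiSum_eq_neg_one_add (by norm_num)
    (quarticCharacter_pow_four hχ) (quarticCharacter_pow_four hχ) hdvd hI
  obtain ⟨z, hz⟩ := h.imp fun _ hz => And.right hz
  rw [hz, show (gaussI - 1) ^ 2 = (2 : ℤ) * (-gaussI) by
    have := gaussI_sq; push_cast; linear_combination this, ← mul_assoc, mul_comm z, mul_assoc]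
  simp

/-- π divides J, both have norm p and even imaginary part, so J = ±π. The sign is irrelevant, since
g⁴ involves only J². -/
theorem jacobiSum_quarticCharacter_sq {π : GaussianInt} (hπ : Prime π) (hn : Zsqrtd.norm π = p)
    (him : Even π.im) (hρ : ρ π = 0) : jacobiSum χ χ ^ 2 = π ^ 2 := by
  obtain ⟨κ, hκ⟩ := (GaussianInt.map_eq_zero_iff_dvd hπ ρ hρ _).1
    (map_jacobiSum_quarticCharacter hp hχ)
  have hnorm := norm_jacobiSum_quarticCharacter hp hχ
  have hev := jacobiSum_quarticCharacter_im_even hp hχ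
  have hp0 : (p : ℤ) ≠ 0 := by exact_mod_cast (Fact.out : p.Prime).ne_zero
  rw [hκ, Zsqrtd.norm_mul, hn] at hnorm
  have h1 : κ.re * κ.re + κ.im * κ.im = 1 := by
    have := mul_left_cancel₀ hp0 (hnorm.trans (mul_one _).symm)
    rw [Zsqrtd.norm_def] at this
    linarith
  have hre : Odd π.re := by
    rw [Zsqrtd.norm_def] at hn
    by_contra h
    rw [Int.not_odd_iff_even] at h
    have : Even (p : ℤ) := by
      rw [← hn]
      exact (h.mul_right _).sub ((him.mul_left _).mul_right _)
    obtain ⟨k, hk⟩ := this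
    omega
  rw [hκ, Zsqrtd.im_mul] at hev
  have hκim : Even κ.im := by
    have h2 : Even (π.re * κ.im) := by
      have := (Int.even_add.1 hev).2 (him.mul_right _)
      exact this
    rcases Int.even_mul.1 h2 with h | h
    · exact absurd hre (Int.not_odd_iff_even.2 h)
    · exact h
  have hκ0 : κ.im = 0 := by
    obtain ⟨k, hk⟩ := hκim
    by_contra h
    have : 0 < k * k := by
      rcases lt_trichotomy k 0 with h' | h' | h'
      · nlinarith
      · omega
      · nlinarith
    rw [hk] at h1
    nlinarith [mul_self_nonneg κ.re]
  have : κ ^ 2 = 1 := by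
    rw [hκ0] at h1
    rw [sq]
    ext
    · rw [Zsqrtd.re_mul, hκ0, Zsqrtd.re_one]; linarith
    · rw [Zsqrtd.im_mul, hκ0, Zsqrtd.im_one]; ring
  rw [hκ, mul_pow, this, mul_one]

variable {K : Type*} [Field K] (φ : GaussianInt →+* K) (h2 : (2 : K) ≠ 0)
  {ψ : AddChar (ZMod p) K} (hψ : ψ.IsPrimitive)
include h2

theorem quarticCharacter_ringHomComp_mul_self_ne_one :
    χ.ringHomComp φ * χ.ringHomComp φ ≠ 1 := by
  intro h
  apply quarticCharacter_mul_self_ne_one hp hχ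
  ext1 a
  rw [MulChar.one_apply_coe]
  have h1 : (χ.ringHomComp φ * χ.ringHomComp φ) a = 1 := by rw [h, MulChar.one_apply_coe]
  rw [← MulChar.ringHomComp_mul, MulChar.ringHomComp_apply] at h1
  obtain ⟨k, hk⟩ := quarticCharacter_apply_unit hχ a
  exact gaussI_pow_eq_of_map_eq φ h2 (Or.inr ⟨k + k, by rw [MulChar.mul_apply, hk, pow_add]⟩)
    (Or.inr ⟨0, by rw [pow_zero]⟩) (by rw [h1, map_one])

include hψ

/-- g(χ)² = J(χ, χ) g(χ²), and the quadratic Gauss sum has square χ²(-1) p = p. -/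
theorem gaussSum_quarticCharacter_pow_four :
    gaussSum (χ.ringHomComp φ) ψ ^ 4 = p * φ (jacobiSum χ χ) ^ 2 := by
  have hne := quarticCharacter_ringHomComp_mul_self_ne_one hp hχ φ h2
  have h := jacobiSum_mul_nontrivial hne ψ
  have hq : (χ.ringHomComp φ * χ.ringHomComp φ).IsQuadratic := by
    intro a
    have h4 : (χ ^ 4) a = 0 ∨ (χ ^ 4) a = 1 := by
      by_cases ha : IsUnit a
      · right; rw [quarticCharacter_pow_four hχ, MulChar.one_apply ha]
      · left; rw [MulChar.map_nonunit _ ha]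
    rw [MulChar.mul_apply, MulChar.ringHomComp_apply, ← map_mul]
    rw [MulChar.pow_apply' _ (by norm_num)] at h4
    rcases h4 with h4 | h4
    · left
      rw [eq_zero_of_pow_eq_zero h4, mul_zero, map_zero]
    · right
      have := congrArg φ h4
      rw [map_one] at this
      exact sq_eq_one_iff.1 (by rw [← map_pow, ← this]; ring_nf)
  have hs := gaussSum_sq hne hq hψ
  have h1 : (χ.ringHomComp φ * χ.ringHomComp φ) (-1) = 1 := by
    rw [MulChar.mul_apply, ← map_mul, neg_one_mul, neg_neg, MulChar.map_one]
  rw [h1, one_mul, ZMod.card] at hs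
  rw [jacobiSum_ringHomComp] at h
  calc gaussSum (χ.ringHomComp φ) ψ ^ 4
      = (gaussSum (χ.ringHomComp φ) ψ * gaussSum (χ.ringHomComp φ) ψ) ^ 2 := by ring
    _ = _ := by rw [← h, mul_pow, hs]

end

end Character

/-! ### Quartic reciprocity with a rational integer -/

theorem GaussianInt.exists_ringHom_zmod {p : ℕ} [Fact p.Prime] (hp : p % 4 = 1) {π : GaussianInt}
    (hn : Zsqrtd.norm π = p) : ∃ ρ : GaussianInt →+* ZMod p, ρ π = 0 := by
  obtain ⟨j, hj⟩ := ZMod.exists_sq_eq_neg_one_iff.2 (show p % 4 ≠ 3 by omega)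
  let φ : GaussianInt →+* ZMod p := Zsqrtd.lift ⟨j, by rw [← hj]; norm_num⟩
  have h : φ π * φ (star π) = 0 := by
    rw [← map_mul, ← Zsqrtd.norm_eq_mul_conj, hn]; simp
  rcases mul_eq_zero.1 h with h | h
  · exact ⟨φ, h⟩
  · exact ⟨φ.comp (starRingEnd GaussianInt), by simpa [starRingEnd_apply] using h⟩

theorem AddChar.exists_isPrimitive_zmod (l p : ℕ) [Fact l.Prime] [Fact p.Prime] (h : l ≠ p) :
    ∃ ψ : AddChar (ZMod p) (AlgebraicClosure (ZMod l)), ψ.IsPrimitive := by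
  have hp : (p : ZMod l) ≠ 0 := by
    rw [Ne, CharP.cast_eq_zero_iff (ZMod l) l, Nat.prime_dvd_prime_iff_eq Fact.out Fact.out]
    exact h
  have : NeZero (p : ZMod l) := ⟨hp⟩
  obtain ⟨ζ, hζ⟩ := HasEnoughRootsOfUnity.exists_primitiveRoot (AlgebraicClosure (ZMod l)) p
  exact ⟨_, AddChar.zmodChar_primitive_of_primitive_root p hζ⟩

/-- Quartic reciprocity between a Gaussian prime of prime norm and a rational prime. -/
theorem HasQuarticIndex.reciprocity_prime {p l : ℕ} [hpf : Fact p.Prime] [hlf : Fact l.Prime]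
    (hp : p % 4 = 1) (hl : Odd (l : ℤ)) (hlp : l ≠ p) {π : GaussianInt} (hπ : Prime π)
    (hn : Zsqrtd.norm π = p) (him : Even π.im) {n : ℤ}
    (h : HasQuarticIndex ((l : ℤ).primarySign : GaussianInt) π n) :
    HasQuarticIndex π ((l : ℤ) : GaussianInt) n := by
  obtain ⟨ρ, hρ⟩ := GaussianInt.exists_ringHom_zmod hp hn
  obtain ⟨χ, hχ⟩ := exists_quarticCharacter ρ hp
  obtain ⟨φ⟩ := GaussianInt.nonempty_ringHom_algebraicClosure l
  obtain ⟨ψ, hψ⟩ := AddChar.exists_isPrimitive_zmod l p hlp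
  have ho : Odd (Zsqrtd.norm π) := by rw [hn]; exact ⟨p / 2, by omega⟩
  have hl2 : l ≠ 2 := by rintro rfl; revert hl; decide
  have h2 : (2 : AlgebraicClosure (ZMod l)) ≠ 0 := by
    have : ((2 : ℕ) : AlgebraicClosure (ZMod l)) ≠ 0 := by
      rw [Ne, CharP.cast_eq_zero_iff _ l, Nat.prime_dvd_prime_iff_eq hlf.out Nat.prime_two]
      exact hl2
    exact_mod_cast this
  have h2p : (2 : ZMod p) ≠ 0 := GaussianInt.two_ne_zero_of_odd_norm ho ρ hρ
  have hlp0 : (l : ZMod p) ≠ 0 := by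
    rw [Ne, CharP.cast_eq_zero_iff (ZMod p) p, Nat.prime_dvd_prime_iff_eq hpf.out hlf.out]
    exact hlp.symm
  have hpl0 : (p : AlgebraicClosure (ZMod l)) ≠ 0 := by
    rw [Ne, CharP.cast_eq_zero_iff _ l, Nat.prime_dvd_prime_iff_eq hlf.out hpf.out]
    exact hlp
  have hs0 : (((l : ℤ).primarySign : ℤ) : ZMod p) ≠ 0 := by
    rcases Int.primarySign_eq_or (l : ℤ) with h | h <;> rw [h] <;> simpa using hlp0
  -- the character at `±l`
  have hval : φ (χ ((l : ℤ).primarySign : ZMod p)) = φ gaussI ^ n := by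
    rw [HasQuarticIndex.prime_iff hπ ho ρ hρ (by rwa [map_intCast]), hn, Int.natAbs_natCast,
      map_intCast, ← (hχ _).2] at h
    obtain ⟨k, hk⟩ := quarticCharacter_apply_unit hχ (Units.mk0 _ hs0)
    rw [Units.val_mk0] at hk
    rw [hk, map_pow, ← zpow_natCast,
      zpow_eq_zpow_iff_of_sq_eq_neg_one (map_gaussI_sq ρ) h2p] at h
    rwa [hk, map_pow, ← zpow_natCast, zpow_eq_zpow_iff_of_sq_eq_neg_one (map_gaussI_sq φ) h2]
  have hAB : φ π * φ (star π) = p := by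
    rw [← map_mul, ← Zsqrtd.norm_eq_mul_conj, hn]; simp
  have hA0 : φ π ≠ 0 := left_ne_zero_of_mul (hAB ▸ hpl0)
  have hB0 : φ (star π) ≠ 0 := right_ne_zero_of_mul (hAB ▸ hpl0)
  have hcop : IsCoprime π ((l : ℤ) : GaussianInt) := by
    have : IsCoprime ((p : ℤ) : GaussianInt) ((l : ℤ) : GaussianInt) :=
      GaussianInt.isCoprime_intCast
        (Nat.isCoprime_iff_coprime.2 ((Nat.coprime_primes hpf.out hlf.out).2 hlp.symm))
    rw [← hn, Zsqrtd.norm_eq_mul_conj] at this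
    exact this.of_mul_left_left
  have hg4 := gaussSum_quarticCharacter_pow_four hp hχ φ h2 hψ
  rw [← map_pow, jacobiSum_quarticCharacter_sq hp hχ hπ hn him hρ, map_pow, ← hAB] at hg4
  have hχ4 : χ.ringHomComp φ ^ 4 = 1 := by
    rw [MulChar.ringHomComp_pow, quarticCharacter_pow_four hχ, MulChar.ringHomComp_one]
  have hne : χ.ringHomComp φ ≠ 1 := by
    intro h
    apply quarticCharacter_ringHomComp_mul_self_ne_one hp hχ φ h2
    rw [h, one_mul]
  set g := gaussSum (χ.ringHomComp φ) ψ with hg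
  have hg0 : g ≠ 0 := by
    intro h0
    rw [h0, zero_pow (by norm_num)] at hg4
    exact mul_ne_zero (mul_ne_zero hA0 hB0) (pow_ne_zero 2 hA0) hg4.symm
  -- Frobenius raises the values of both characters to the l-th power; for the additive one this
  -- multiplies the argument by l.
  have hfrob : g ^ l = gaussSum (χ.ringHomComp φ ^ l) (ψ.mulShift (Units.mk0 _ hlp0)) := by
    rw [hg, gaussSum_frob, AddChar.pow_mulShift, Units.val_mk0]
  rw [HasQuarticIndex.natPrime_iff φ hl hcop]
  have h4 : l % 4 = 1 ∨ l % 4 = 3 := by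
    have := hlf.out.eq_two_or_odd; omega
  rcases h4 with h4 | h4
  -- Here χ^l = χ, so (g⁴)^f = χ(l)⁻¹, and φ(π)^(4f) = 1 turns the left side into a power of φ(star
  -- π)/φ(π).
  · obtain ⟨f, rfl⟩ : ∃ f, l = 4 * f + 1 := ⟨l / 4, by omega⟩
    have hs : ((4 * f + 1 : ℕ) : ℤ).primarySign = ((4 * f + 1 : ℕ) : ℤ) := by
      unfold Int.primarySign; rw [if_pos (by omega)]
    have hq : ((4 * f + 1 : ℕ) : ℤ).primaryQuarter = (f : ℤ) := by
      unfold Int.primaryQuarter; rw [hs]; omega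
    have hpow : χ.ringHomComp φ ^ (4 * f + 1) = χ.ringHomComp φ := by
      rw [pow_succ, pow_mul, hχ4, one_pow, one_mul]
    rw [hpow, gaussSum_mulShift_eq, ← hg, pow_succ] at hfrob
    have hfrob' := mul_right_cancel₀ hg0 hfrob
    rw [hs] at hval
    have hX : (χ.ringHomComp φ)⁻¹ (Units.mk0 _ hlp0 : (ZMod p)ˣ) * φ gaussI ^ n = 1 := by
      rw [← hval, Int.cast_natCast]
      have : φ (χ ((4 * f + 1 : ℕ) : ZMod p)) =
          χ.ringHomComp φ (Units.mk0 _ hlp0 : (ZMod p)ˣ) := rfl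
      rw [this, ← MulChar.mul_apply, inv_mul_cancel, MulChar.one_apply_coe]
    have hAl := GaussianInt.map_pow_char_of_one φ _ h4 π
    have hA1 : φ π ^ (4 * f) = 1 := by
      rw [pow_succ] at hAl
      exact mul_right_cancel₀ hA0 (hAl.trans (one_mul _).symm)
    rw [← hfrob', pow_mul, hg4] at hX
    rw [hq, zpow_natCast, div_pow, div_eq_iff (pow_ne_zero _ hB0)]
    calc φ π ^ f = φ π ^ f * ((φ π * φ (star π) * φ π ^ 2) ^ f * φ gaussI ^ n) := by
          rw [hX, mul_one]
      _ = φ π ^ (4 * f) * (φ gaussI ^ n * φ (star π) ^ f) := by ring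
      _ = _ := by rw [hA1, one_mul]
  -- Here χ^l = χ⁻¹. Multiplying g^l by g and using g(χ, ψ) g(χ⁻¹, ψ⁻¹) = p gives g^(l+1) = χ(-l) p,
  -- where -l is the normalized sign.
  · obtain ⟨f, rfl⟩ : ∃ f, l = 4 * f + 3 := ⟨l / 4, by omega⟩
    have hs : ((4 * f + 3 : ℕ) : ℤ).primarySign = -((4 * f + 3 : ℕ) : ℤ) := by
      unfold Int.primarySign; rw [if_neg (by omega)]
    have hq : ((4 * f + 3 : ℕ) : ℤ).primaryQuarter = -((f + 1 : ℕ) : ℤ) := by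
      unfold Int.primaryQuarter; rw [hs]; push_cast; omega
    have hinv : χ.ringHomComp φ ^ 3 = (χ.ringHomComp φ)⁻¹ := by
      apply eq_inv_of_mul_eq_one_left
      rw [← pow_succ, hχ4]
    have hpow : χ.ringHomComp φ ^ (4 * f + 3) = (χ.ringHomComp φ)⁻¹ := by
      rw [pow_add, pow_mul, hχ4, one_pow, one_mul, hinv]
    rw [hpow, gaussSum_mulShift_eq, inv_inv,
      ← mul_gaussSum_inv_eq_gaussSum, ← mul_assoc] at hfrob
    have hc := gaussSum_mul_gaussSum_eq_card hne hψ
    rw [← hg, ZMod.card] at hc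
    have hX : χ.ringHomComp φ (Units.mk0 _ hlp0 : (ZMod p)ˣ) * (χ.ringHomComp φ)⁻¹ (-1) =
        φ gaussI ^ n := by
      rw [← hinv, MulChar.pow_apply' _ (by norm_num), ← map_pow, ← map_mul, ← hval, hs]
      simp only [MulChar.ringHomComp_apply, Units.val_mk0, Int.cast_neg, Int.cast_natCast]
      congr 2
      ring
    have hAl := GaussianInt.map_pow_char_of_three φ _ h4 π
    have hA1 : φ π ^ (4 * (f + 1)) = φ π * φ (star π) := by
      rw [← hAl]; ring
    have hfin : (φ π * φ (star π) * φ π ^ 2) ^ (f + 1) =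
        φ gaussI ^ n * φ π ^ (4 * (f + 1)) := by
      rw [← hg4, ← pow_mul, hA1, hAB, ← hc, ← hX, show 4 * (f + 1) = 4 * f + 3 + 1 by ring,
        pow_succ, hfrob]
      ring
    rw [hq, zpow_neg, zpow_natCast, div_pow, inv_div, div_eq_iff (pow_ne_zero _ hA0)]
    have h3 : φ π ^ (3 * (f + 1)) ≠ 0 := pow_ne_zero _ hA0
    apply mul_right_cancel₀ h3
    calc φ (star π) ^ (f + 1) * φ π ^ (3 * (f + 1))
        = (φ π * φ (star π) * φ π ^ 2) ^ (f + 1) := by ring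
      _ = _ := by rw [hfin]; ring

theorem GaussianInt.odd_re_of_odd_norm {α : GaussianInt} (ho : Odd (Zsqrtd.norm α))
    (him : Even α.im) : Odd α.re := by
  rw [Zsqrtd.norm_def] at ho
  by_contra h
  rw [Int.not_odd_iff_even] at h
  exact (Int.not_even_iff_odd.2 ho) ((h.mul_right _).sub ((him.mul_left _).mul_right _))

theorem GaussianInt.odd_norm_iff_of_even_im {α : GaussianInt} (him : Even α.im) :
    Odd (Zsqrtd.norm α) ↔ Odd α.re := by
  refine ⟨fun h => GaussianInt.odd_re_of_odd_norm h him, fun h => ?_⟩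
  rw [Zsqrtd.norm_def]
  exact (h.mul h).sub_even ((him.mul_left _).mul_right _)

/-- An element of odd norm has an associate with even imaginary part. -/
theorem GaussianInt.exists_unit_mul_even_im {α : GaussianInt} (ho : Odd (Zsqrtd.norm α)) :
    ∃ u : GaussianInt, IsUnit u ∧ Even (u * α).im := by
  rcases Int.even_or_odd α.im with h | h
  · exact ⟨1, isUnit_one, by rwa [one_mul]⟩
  · refine ⟨gaussI, isUnit_gaussI, ?_⟩
    have hre : Even α.re := by
      by_contra h'
      rw [Int.not_even_iff_odd] at h'
      rw [Zsqrtd.norm_def, mul_assoc, neg_one_mul, sub_neg_eq_add] at ho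
      exact (Int.not_even_iff_odd.2 ho) ((h'.mul h').add_odd (h.mul h))
    have : (gaussI * α).im = α.re := by simp [gaussI]
    rwa [this]

theorem GaussianInt.even_im_of_mul {α β : GaussianInt} (hα : Odd α.re) (hα' : Even α.im)
    (h : Even (α * β).im) : Even β.im := by
  rw [Zsqrtd.im_mul] at h
  rcases Int.even_mul.1 ((Int.even_add.1 h).2 (hα'.mul_right _)) with h | h
  · exact absurd hα (Int.not_odd_iff_even.2 h)
  · exact h

/-- A Gaussian unit with even imaginary part is `1` or `-1`. -/
theorem GaussianInt.eq_one_or_neg_one_of_isUnit {u : GaussianInt} (hu : IsUnit u)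
    (him : Even u.im) : u = 1 ∨ u = -1 := by
  rw [← Zsqrtd.norm_eq_one_iff' (by norm_num), Zsqrtd.norm_def] at hu
  obtain ⟨k, hk⟩ := him
  have hk0 : k = 0 := by
    by_contra h
    have h0 : 0 < k * k := by
      rcases lt_or_gt_of_ne h with h' | h' <;> nlinarith
    rw [hk] at hu
    nlinarith [mul_self_nonneg u.re]
  subst hk0
  rw [hk] at hu
  have : u.re * u.re = 1 := by linarith
  rcases mul_self_eq_one_iff.1 this with h | h
  · left; ext <;> simp [h, hk]
  · right; ext <;> simp [h, hk]

theorem isCoprime_primarySign_iff {m : ℤ} {α : GaussianInt} :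
    IsCoprime (m.primarySign : GaussianInt) α ↔ IsCoprime (m : GaussianInt) α := by
  rcases Int.primarySign_eq_or m with h | h <;> rw [h]
  rw [Int.cast_neg, IsCoprime.neg_left_iff]

theorem GaussianInt.isCoprime_of_isCoprime_intCast {a b : ℤ}
    (h : IsCoprime (a : GaussianInt) (b : GaussianInt)) : IsCoprime a b := by
  obtain ⟨x, y, hxy⟩ := h
  refine ⟨x.re, y.re, ?_⟩
  have := congrArg Zsqrtd.re hxy
  simpa using this

/-- Either π has prime norm and Gauss sums apply, or π is a rational prime up to sign, because its
imaginary part is even, and both symbols are 1. -/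
theorem HasQuarticIndex.reciprocity_natPrime_prime {l : ℕ} [hlf : Fact l.Prime]
    (hl : Odd (l : ℤ)) {π : GaussianInt} (hπ : Prime π) (ho : Odd (Zsqrtd.norm π))
    (him : Even π.im) (hc : IsCoprime π ((l : ℤ) : GaussianInt)) {n : ℤ}
    (h : HasQuarticIndex ((l : ℤ).primarySign : GaussianInt) π n) :
    HasQuarticIndex π ((l : ℤ) : GaussianInt) n := by
  obtain ⟨p, hp, hd, h1 | h3⟩ := GaussianInt.exists_prime_of_odd_norm hπ ho
  · have : Fact p.Prime := ⟨hp⟩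
    have hn : Zsqrtd.norm π = p := by
      rw [← GaussianInt.abs_natCast_norm, h1.2]
    refine HasQuarticIndex.reciprocity_prime h1.1 hl ?_ hπ hn him h
    rintro rfl
    exact hπ.not_isUnit (hc.isUnit_of_dvd' dvd_rfl (by rwa [Int.cast_natCast]))
  · have : Fact p.Prime := ⟨hp⟩
    have hpp := GaussianInt.prime_of_nat_prime_of_mod_four_eq_three p h3.1
    obtain ⟨u, hu⟩ := (hπ.associated_of_dvd hpp hd).symm
    have hpo : Odd (p : ℤ) := ⟨p / 2, by omega⟩
    have hev : Even (u : GaussianInt).im := by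
      refine GaussianInt.even_im_of_mul (α := p) (by simpa using hpo) (by simp) ?_
      rwa [hu]
    obtain ⟨a, rfl⟩ : ∃ a : ℤ, π = a := by
      rcases GaussianInt.eq_one_or_neg_one_of_isUnit u.isUnit hev with h | h
      · exact ⟨p, by rw [← hu, h]; simp⟩
      · exact ⟨-p, by rw [← hu, h]; simp⟩
    have hao : Odd a := by
      rw [Zsqrtd.norm_intCast] at ho
      exact (Int.odd_mul.1 ho).1
    have hcz : IsCoprime a (l : ℤ) := GaussianInt.isCoprime_of_isCoprime_intCast hc
    have hcs : IsCoprime (l : ℤ).primarySign a := by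
      rcases Int.primarySign_eq_or (l : ℤ) with h | h <;> rw [h]
      · exact hcz.symm
      · exact hcz.symm.neg_left
    exact (HasQuarticIndex.intCast hl hcz).of_emod_eq ((HasQuarticIndex.intCast hao hcs).unique h)

theorem HasQuarticIndex.reciprocity_of_prime {m : ℤ} (hm : Odd m) {π : GaussianInt}
    (hπ : Prime π) (ho : Odd (Zsqrtd.norm π)) (him : Even π.im)
    (hc : IsCoprime π (m : GaussianInt)) {n : ℤ}
    (h : HasQuarticIndex (m.primarySign : GaussianInt) π n) :
    HasQuarticIndex π (m : GaussianInt) n := by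
  revert n
  revert hc
  refine Int.odd_induction (P := fun m => IsCoprime π (m : GaussianInt) → ∀ {n : ℤ},
    HasQuarticIndex (m.primarySign : GaussianInt) π n → HasQuarticIndex π (m : GaussianInt) n)
    ?_ ?_ ?_ ?_ m hm
  · intro _ n h
    have h1 : HasQuarticIndex ((1 : ℤ).primarySign : GaussianInt) π 0 := by
      simpa [Int.primarySign] using (h.pow_left ho 0)
    exact (HasQuarticIndex.of_isUnit (by simp)).of_emod_eq (h1.unique h)
  · intro m hm ih hc n h
    have hs : (-m).primarySign = m.primarySign := by
      obtain ⟨k, rfl⟩ := hm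
      unfold Int.primarySign
      split_ifs <;> omega
    rw [hs] at h
    exact (ih (hc.of_isCoprime_of_dvd_right (associated_intCast_neg m).dvd) h).neg_right
  · intro l hl hlo hc n h
    have : Fact l.Prime := ⟨hl⟩
    exact HasQuarticIndex.reciprocity_natPrime_prime hlo hπ ho him hc h
  · intro a b ha hb iha ihb hc n h
    have hca := hc.gaussianInt_of_mul_right_left
    have hcb := hc.gaussianInt_of_mul_right_right
    obtain ⟨i, hi⟩ := HasQuarticIndex.exists_of_isCoprime ho
      (isCoprime_primarySign_iff.2 hca.symm)
    obtain ⟨j, hj⟩ := HasQuarticIndex.exists_of_isCoprime ho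
      (isCoprime_primarySign_iff.2 hcb.symm)
    rw [Int.primarySign_mul ha hb, Int.cast_mul] at h
    exact (iha hca hi).intCast_mul_right ha hb (ihb hcb hj) ((hi.mul_left hj ho).unique h)

/-- Prime factors of an element with even imaginary part need not have even imaginary part. The free
unit w lets the induction normalize each prime and pass the inverse unit to the cofactor. -/
theorem HasQuarticIndex.reciprocity_aux {m : ℤ} (hm : Odd m) (α : GaussianInt) :
    ∀ w : GaussianInt, IsUnit w → Odd (Zsqrtd.norm (w * α)) → Even (w * α).im →
      IsCoprime (w * α) (m : GaussianInt) → ∀ n : ℤ,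
      HasQuarticIndex (m.primarySign : GaussianInt) (w * α) n →
      HasQuarticIndex (w * α) (m : GaussianInt) n := by
  refine UniqueFactorizationMonoid.induction_on_prime α ?_ ?_ ?_
  · intro w _ ho
    simp at ho
  · intro u hu w hw ho him hc n h
    have hn : (0 : ℤ) % 4 = n % 4 := (HasQuarticIndex.of_isUnit (hw.mul hu)).unique h
    refine HasQuarticIndex.of_emod_eq (m := 0) ?_ hn
    rcases GaussianInt.eq_one_or_neg_one_of_isUnit (hw.mul hu) him with h1 | h1 <;> rw [h1]
    · have := HasQuarticIndex.intCast (a := 1) hm isCoprime_one_left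
      rwa [Int.cast_one] at this
    · have := HasQuarticIndex.intCast (a := -1) hm isCoprime_one_left.neg_left
      rwa [Int.cast_neg, Int.cast_one] at this
  · intro β π _ hπ ih w hw ho him hc n h
    have hoπ : Odd (Zsqrtd.norm π) :=
      GaussianInt.odd_norm_of_dvd (Dvd.intro _ (mul_left_comm π w β)) ho
    obtain ⟨u, hu, hev⟩ := GaussianInt.exists_unit_mul_even_im hoπ
    obtain ⟨v, hv⟩ := hu.exists_right_inv
    have hsplit : w * (π * β) = (u * π) * ((w * v) * β) := by
      linear_combination (-w * π * β) * hv
    rw [hsplit] at ho him hc h ⊢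
    rw [Zsqrtd.norm_mul] at ho
    obtain ⟨ho1, ho2⟩ := Int.odd_mul.1 ho
    have hre := GaussianInt.odd_re_of_odd_norm ho1 hev
    have hev2 := GaussianInt.even_im_of_mul hre hev him
    have hv' : IsUnit v := IsUnit.of_mul_eq_one u (by rw [mul_comm, hv])
    have hc1 := hc.of_mul_left_left
    have hc2 := hc.of_mul_left_right
    obtain ⟨i, hi⟩ := HasQuarticIndex.exists_of_isCoprime ho1
      (isCoprime_primarySign_iff.2 hc1.symm)
    obtain ⟨j, hj⟩ := HasQuarticIndex.exists_of_isCoprime ho2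
      (isCoprime_primarySign_iff.2 hc2.symm)
    have hπ' : Prime (u * π) := (associated_unit_mul_left π u hu).symm.prime hπ
    have h1 := HasQuarticIndex.reciprocity_of_prime hm hπ' ho1 hev hc1 hi
    have h2 := ih (w * v) (hw.mul hv') ho2 hev2 hc2 j hj
    exact (h1.mul_left h2 (GaussianInt.odd_norm_intCast hm)).of_emod_eq
      ((hi.mul_right hj ho1 ho2).unique h)

/-- Quartic reciprocity between a Gaussian integer of odd norm with even imaginary part
and an odd rational integer. -/
theorem HasQuarticIndex.reciprocity {m : ℤ} (hm : Odd m) {α : GaussianInt}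
    (ho : Odd (Zsqrtd.norm α)) (him : Even α.im) (hc : IsCoprime α (m : GaussianInt)) {n : ℤ} :
    HasQuarticIndex (m.primarySign : GaussianInt) α n ↔
      HasQuarticIndex α (m : GaussianInt) n := by
  have key : ∀ k, HasQuarticIndex (m.primarySign : GaussianInt) α k →
      HasQuarticIndex α (m : GaussianInt) k := fun k h => by
    have := HasQuarticIndex.reciprocity_aux hm α 1 isUnit_one
    simp only [one_mul] at this
    exact this ho him hc k h
  refine ⟨key n, fun h => ?_⟩
  obtain ⟨k, hk⟩ := HasQuarticIndex.exists_of_isCoprime ho (isCoprime_primarySign_iff.2 hc.symm)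
  exact hk.of_emod_eq ((key k hk).unique h)

/-! ### Supplementary laws for i, -1, 1 + i and 2 -/

theorem GaussianInt.norm_emod_four {α : GaussianInt} (ho : Odd (Zsqrtd.norm α)) :
    Zsqrtd.norm α % 4 = 1 := by
  rw [Zsqrtd.norm_def] at ho ⊢
  rcases Int.even_or_odd' α.re with ⟨a, ha | ha⟩ <;> rcases Int.even_or_odd' α.im with ⟨b, hb | hb⟩
    <;> rw [ha, hb] at ho ⊢
  · exfalso; obtain ⟨k, hk⟩ := ho; ring_nf at hk; omega
  · ring_nf; omega
  · ring_nf; omega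
  · exfalso; obtain ⟨k, hk⟩ := ho; ring_nf at hk; omega

/-- The supplementary law for `i`. -/
theorem HasQuarticIndex.gaussI_left {α : GaussianInt} (ho : Odd (Zsqrtd.norm α)) :
    HasQuarticIndex gaussI α ((Zsqrtd.norm α - 1) / 4) := by
  revert ho
  refine UniqueFactorizationMonoid.induction_on_prime α ?_ ?_ ?_
  · intro ho; simp at ho
  · intro u hu _
    rw [(Zsqrtd.norm_eq_one_iff' (by norm_num) u).2 hu]
    exact HasQuarticIndex.of_isUnit hu
  · intro β π _ hπ ih ho
    have hoπ : Odd (Zsqrtd.norm π) := GaussianInt.odd_norm_of_dvd (dvd_mul_right _ _) ho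
    have hoβ : Odd (Zsqrtd.norm β) := GaussianInt.odd_norm_of_dvd (dvd_mul_left _ _) ho
    obtain ⟨K, _, φ, h0⟩ := GaussianInt.exists_field_of_prime hπ
    have h1 : HasQuarticIndex gaussI π ((Zsqrtd.norm π - 1) / 4) := by
      rw [HasQuarticIndex.prime_iff hπ hoπ φ h0 (map_gaussI_ne_zero φ), ← zpow_natCast]
      congr 1
      have := GaussianInt.abs_natCast_norm π
      have := GaussianInt.norm_emod_four hoπ
      omega
    refine (h1.mul_right (ih hoβ) hoπ hoβ).of_emod_eq ?_
    have h4 := GaussianInt.norm_emod_four hoπ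
    have h4' := GaussianInt.norm_emod_four hoβ
    obtain ⟨a, ha⟩ : ∃ a, Zsqrtd.norm π = 4 * a + 1 := ⟨Zsqrtd.norm π / 4, by omega⟩
    obtain ⟨b, hb⟩ : ∃ b, Zsqrtd.norm β = 4 * b + 1 := ⟨Zsqrtd.norm β / 4, by omega⟩
    rw [Zsqrtd.norm_mul, ha, hb,
      show (4 * a + 1) * (4 * b + 1) - 1 = 4 * (4 * (a * b) + a + b) by ring,
      Int.mul_ediv_cancel_left _ (by norm_num)]
    omega

/-- The supplementary law for `-1`. -/
theorem HasQuarticIndex.neg_one {α : GaussianInt} (ho : Odd (Zsqrtd.norm α))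
    (him : Even α.im) : HasQuarticIndex (-1) α α.im := by
  have h := (HasQuarticIndex.gaussI_left ho).pow_left ho 2
  rw [gaussI_sq] at h
  refine h.of_emod_eq ?_
  obtain ⟨a, ha⟩ := GaussianInt.odd_re_of_odd_norm ho him
  obtain ⟨b, hb⟩ := him
  rw [Zsqrtd.norm_def, ha, hb,
    show (2 * a + 1) * (2 * a + 1) - -1 * (b + b) * (b + b) - 1 = 4 * (a * (a + 1) + b * b) by
      ring, Int.mul_ediv_cancel_left _ (by norm_num)]
  have h1 : a * (a + 1) % 2 = 0 := Int.even_iff.1 (Int.even_mul_succ_self a)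
  have h2 : (b * b) % 2 = b % 2 := by
    rw [Int.mul_emod]
    rcases Int.emod_two_eq_zero_or_one b with h | h <;> rw [h] <;> norm_num
  push_cast
  omega

/-- Replacing the normalized ±m by m costs at most the symbol of -1, which is i^(Im α). -/
theorem HasQuarticIndex.sign_mul {α : GaussianInt} (ho : Odd (Zsqrtd.norm α))
    (him : Even α.im) {m n : ℤ} (h : HasQuarticIndex (m.primarySign : GaussianInt) α n) :
    HasQuarticIndex (m : GaussianInt) α (n + if m % 4 = 1 then 0 else α.im) := by
  unfold Int.primarySign at h
  split_ifs at h ⊢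
  · rwa [add_zero]
  · have := h.mul_left (HasQuarticIndex.neg_one ho him) ho
    rwa [Int.cast_neg, mul_neg_one, neg_neg] at this

/-- The supplementary law for `1 - i` modulo a rational integer. -/
theorem HasQuarticIndex.one_sub_gaussI {m : ℤ} (hm : Odd m) :
    HasQuarticIndex (1 - gaussI) (m : GaussianInt) (-m.primaryQuarter) := by
  have ho := GaussianInt.odd_norm_intCast hm
  have h1 := HasQuarticIndex.intCast (a := -1) hm isCoprime_one_left.neg_left
  have h := ((HasQuarticIndex.one_add_gaussI hm).mul_left
    (HasQuarticIndex.gaussI_intCast hm) ho).mul_left h1 ho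
  rw [show (1 + gaussI) * gaussI * ((-1 : ℤ) : GaussianInt) = 1 - gaussI by
    have := gaussI_sq; push_cast; linear_combination -this] at h
  exact h.of_emod_eq (by omega)

section Supplement

variable {a b : ℤ}

theorem GaussianInt.odd_norm_mk (ha : Odd a) (hb : Even b) :
    Odd (Zsqrtd.norm (⟨a, b⟩ : GaussianInt)) :=
  (GaussianInt.odd_norm_iff_of_even_im hb).2 ha

theorem GaussianInt.mk_eq (a b : ℤ) :
    (⟨a, b⟩ : GaussianInt) = (a : GaussianInt) + (b : GaussianInt) * gaussI :=
  GaussianInt.eq_add_mul_gaussI ⟨a, b⟩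

theorem GaussianInt.isCoprime_of_norm {α : GaussianInt} {m : ℤ}
    (h : IsCoprime (Zsqrtd.norm α) m) : IsCoprime α (m : GaussianInt) := by
  have := GaussianInt.isCoprime_intCast h
  rw [Zsqrtd.norm_eq_mul_conj] at this
  exact this.of_mul_left_left

/-- a + bi ≡ bi (mod a) and b has symbol 1, so reciprocity leaves the symbol of i modulo a. -/
theorem HasQuarticIndex.re_primarySign (ha : Odd a) (hb : Even b) (h : IsCoprime a b) :
    HasQuarticIndex (a.primarySign : GaussianInt) (⟨a, b⟩ : GaussianInt)
      (2 * a.primaryQuarter) := by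
  have ho := GaussianInt.odd_norm_mk ha hb
  have hoa := GaussianInt.odd_norm_intCast ha
  have hc : IsCoprime (⟨a, b⟩ : GaussianInt) (a : GaussianInt) := by
    apply GaussianInt.isCoprime_of_norm
    rw [Zsqrtd.norm_def]
    have : IsCoprime (b * b) a := h.symm.mul_left h.symm
    have := IsCoprime.add_mul_right_left this a
    rwa [show b * b + a * a = a * a - -1 * b * b by ring] at this
  rw [HasQuarticIndex.reciprocity ha ho hb hc]
  have h1 := (HasQuarticIndex.intCast ha h.symm).mul_left (HasQuarticIndex.gaussI_intCast ha) hoa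
  rw [zero_add] at h1
  refine h1.congr hoa ?_
  rw [GaussianInt.mk_eq]
  exact ⟨-1, by ring⟩

/-- a + bi ≡ a(1 - i) (mod a + b), so reciprocity leaves the symbol of 1 - i modulo a + b. -/
theorem HasQuarticIndex.re_add_im_primarySign (ha : Odd a) (hb : Even b) (h : IsCoprime a b) :
    HasQuarticIndex ((a + b).primarySign : GaussianInt) (⟨a, b⟩ : GaussianInt)
      (-(a + b).primaryQuarter) := by
  have ho := GaussianInt.odd_norm_mk ha hb
  have hab : Odd (a + b) := ha.add_even hb
  have hoa := GaussianInt.odd_norm_intCast hab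
  have haab : IsCoprime a (a + b) := by
    have := IsCoprime.add_mul_left_right h 1
    rwa [mul_one, add_comm] at this
  have h1 := (HasQuarticIndex.intCast hab haab).mul_left (HasQuarticIndex.one_sub_gaussI hab) hoa
  rw [zero_add] at h1
  have hd : ((a + b : ℤ) : GaussianInt) ∣ (a : GaussianInt) * (1 - gaussI) - ⟨a, b⟩ := by
    rw [GaussianInt.mk_eq]
    exact ⟨-gaussI, by push_cast; ring⟩
  have hc : IsCoprime (⟨a, b⟩ : GaussianInt) ((a + b : ℤ) : GaussianInt) := by
    apply GaussianInt.isCoprime_of_norm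
    rw [Zsqrtd.norm_def]
    have h2 : IsCoprime (2 * (a * a)) (a + b) := by
      refine IsCoprime.mul_left ?_ (haab.mul_left haab)
      obtain ⟨k, hk⟩ := hab
      exact ⟨-k, 1, by rw [hk]; ring⟩
    have := IsCoprime.add_mul_right_left h2 (b - a)
    rwa [show 2 * (a * a) + (b - a) * (a + b) = a * a - -1 * b * b by ring] at this
  rw [HasQuarticIndex.reciprocity hab ho hb hc]
  exact h1.congr hoa hd

/-- The supplementary law for `1 + i`. -/
theorem HasQuarticIndex.one_add_gaussI_mk (ha : Odd a) (hb : Even b) (h : IsCoprime a b) :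
    HasQuarticIndex (1 + gaussI) (⟨a, b⟩ : GaussianInt)
      (-(a + b).primaryQuarter + 2 * a.primaryQuarter + if b % 4 = 0 then 0 else 2) := by
  have ho := GaussianInt.odd_norm_mk ha hb
  have h1 := (HasQuarticIndex.re_primarySign ha hb h).sign_mul ho hb
  have h2 := (HasQuarticIndex.re_add_im_primarySign ha hb h).sign_mul ho hb
  have hc : IsCoprime (1 + gaussI) (⟨a, b⟩ : GaussianInt) := by
    have h2 : IsCoprime (2 : ℤ) (Zsqrtd.norm (⟨a, b⟩ : GaussianInt)) := by
      obtain ⟨k, hk⟩ := ho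
      exact ⟨-k, 1, by rw [hk]; ring⟩
    have h3 := GaussianInt.isCoprime_intCast h2
    rw [Zsqrtd.norm_eq_mul_conj, show ((2 : ℤ) : GaussianInt) =
      (1 + gaussI) * (1 - gaussI) by
        have := gaussI_sq; push_cast; linear_combination this] at h3
    exact h3.of_mul_left_left.of_mul_right_left
  obtain ⟨n, hn⟩ := HasQuarticIndex.exists_of_isCoprime ho hc
  have h3 := h1.mul_left hn ho
  -- Modulo a + bi one has ai ≡ b, so 1 + i is the quotient of a + b by a, whose symbols are known.
  have hd : (⟨a, b⟩ : GaussianInt) ∣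
      (a : GaussianInt) * (1 + gaussI) - ((a + b : ℤ) : GaussianInt) := by
    rw [GaussianInt.mk_eq]
    refine ⟨gaussI, ?_⟩
    have := gaussI_sq
    push_cast
    linear_combination (-(b : GaussianInt)) * this
  have h4 := (h3.congr ho hd).unique h2
  refine hn.of_emod_eq ?_
  obtain ⟨k, rfl⟩ := ha
  obtain ⟨j, rfl⟩ := hb
  dsimp only at h4
  split_ifs at h4 ⊢ <;> omega

/-- The supplementary law for `2`. -/
theorem HasQuarticIndex.two_mk (ha : Odd a) (hb : Even b) (h : IsCoprime a b) :
    HasQuarticIndex ((2 : ℤ) : GaussianInt) (⟨a, b⟩ : GaussianInt) (a * (b / 2)) := by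
  have ho := GaussianInt.odd_norm_mk ha hb
  have h1 := HasQuarticIndex.one_add_gaussI_mk ha hb h
  have h2 := ((h1.pow_left ho 2).mul_left ((HasQuarticIndex.gaussI_left ho).pow_left ho 3) ho)
  -- 2 = (1 + i)² i³ reduces the law to those for 1 + i and i.
  rw [show (1 + gaussI) ^ 2 * gaussI ^ 3 = ((2 : ℤ) : GaussianInt) by
    have := gaussI_sq
    push_cast
    linear_combination (2 * gaussI ^ 2 + gaussI ^ 3 - 2) * this] at h2
  refine h2.of_emod_eq ?_
  have hA := Int.primarySign_eq ha
  have hC := Int.primarySign_eq (ha.add_even hb)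
  obtain ⟨B, rfl⟩ := hb
  set A := a.primaryQuarter
  set C := (a + (B + B)).primaryQuarter
  have hB2 : (B + B) / 2 = B := by omega
  have hsq : B * B % 4 = if B % 2 = 0 then 0 else 1 := by
    rcases Int.even_or_odd' B with ⟨k, hk | hk⟩
    · rw [if_pos (by omega), hk]; ring_nf; omega
    · rw [if_neg (by omega), hk]; ring_nf; omega
  have hN : (Zsqrtd.norm (⟨a, B + B⟩ : GaussianInt) - 1) / 4 = 2 * A + 4 * (A * A) + B * B := by
    rw [Zsqrtd.norm_def]
    dsimp only
    have : a * a = (1 + 4 * A) * (1 + 4 * A) := by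
      rw [← hA]
      rcases Int.primarySign_eq_or a with h | h <;> rw [h]; ring
    rw [this, show (1 + 4 * A) * (1 + 4 * A) - -1 * (B + B) * (B + B) - 1 =
      4 * (2 * A + 4 * (A * A) + B * B) by ring, Int.mul_ediv_cancel_left _ (by norm_num)]
  rw [hN, hB2]
  have ha4 : a % 4 = 1 ∨ a % 4 = 3 := by
    obtain ⟨k, rfl⟩ := ha; omega
  have haB : a * B % 4 = (if a % 4 = 1 then B else -B) % 4 := by
    rcases ha4 with h | h
    · rw [if_pos h, Int.mul_emod, h, one_mul, Int.emod_emod_of_dvd _ (dvd_refl _)]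
    · rw [if_neg (by omega)]
      obtain ⟨k, hk⟩ : ∃ k, a = 4 * k - 1 := ⟨a / 4 + 1, by omega⟩
      rw [hk, show (4 * k - 1) * B = 4 * (k * B) + -B by ring]; omega
  unfold Int.primarySign at hA hC
  generalize a * B = aB at *
  generalize B * B = BB at *
  push_cast
  split_ifs at * <;> omega

end Supplement

/-! ### The relation between the symbols of x, y and q -/

namespace HasQuarticIndex

/-- If 4 divides the imaginary part, -1 has symbol 1 modulo α and no sign normalization is needed;
this covers α = c + di. -/
theorem reciprocity_of_four_dvd_im {α : GaussianInt} (ho : Odd (Zsqrtd.norm α))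
    (him : α.im % 4 = 0) {m : ℤ} (hm : Odd m) (hc : IsCoprime α (m : GaussianInt)) {n : ℤ}
    (h : HasQuarticIndex (m : GaussianInt) α n) : HasQuarticIndex α (m : GaussianInt) n := by
  have hev : Even α.im := Int.even_iff.2 (by omega)
  obtain ⟨k, hk⟩ := exists_of_isCoprime ho (isCoprime_primarySign_iff.2 hc.symm)
  have h1 := (hk.sign_mul ho hev).unique h
  refine ((reciprocity hm ho hev hc).1 hk).of_emod_eq ?_
  split_ifs at h1 <;> omega

/-- The indices modulo `n` of `2 ^ j * i ^ u * (1 + i) ^ ε * α₀` and of `α₀`. -/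
theorem of_mul_two_pow {α₀ : GaussianInt} {n : ℤ} (hn : Odd n) (j u ε : ℕ)
    (hc : IsCoprime (2 ^ j * gaussI ^ u * (1 + gaussI) ^ ε * α₀) (n : GaussianInt)) {k : ℤ}
    (h : HasQuarticIndex (2 ^ j * gaussI ^ u * (1 + gaussI) ^ ε * α₀) (n : GaussianInt) k) :
    HasQuarticIndex α₀ (n : GaussianInt)
      (k - 2 * u * n.primaryQuarter - ε * n.primaryQuarter) := by
  have ho := GaussianInt.odd_norm_intCast hn
  obtain ⟨i, hi⟩ := exists_of_isCoprime ho hc.of_mul_left_right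
  have h2 : HasQuarticIndex ((2 : ℤ) : GaussianInt) (n : GaussianInt) 0 :=
    intCast hn (by obtain ⟨k, rfl⟩ := hn; exact ⟨-k, 1, by ring⟩)
  have h3 := (((h2.pow_left ho j).mul_left ((gaussI_intCast hn).pow_left ho u) ho).mul_left
    ((one_add_gaussI hn).pow_left ho ε) ho).mul_left hi ho
  rw [Int.cast_ofNat] at h3
  have h4 := h3.unique h
  refine hi.of_emod_eq ?_
  have e1 : (u : ℤ) * (2 * n.primaryQuarter) = 2 * u * n.primaryQuarter := by ring
  rw [e1] at h4
  generalize 2 * (u : ℤ) * n.primaryQuarter = A at *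
  generalize (ε : ℤ) * n.primaryQuarter = B at *
  omega

theorem reciprocity_of_mul_two_pow {α₀ : GaussianInt} (ho : Odd (Zsqrtd.norm α₀))
    (him : Even α₀.im) {n : ℤ} (hn : Odd n) (j u ε : ℕ)
    (hc : IsCoprime (2 ^ j * gaussI ^ u * (1 + gaussI) ^ ε * α₀) (n : GaussianInt)) {k : ℤ}
    (h : HasQuarticIndex (2 ^ j * gaussI ^ u * (1 + gaussI) ^ ε * α₀) (n : GaussianInt) k) :
    HasQuarticIndex (n : GaussianInt) α₀
      (k - 2 * u * n.primaryQuarter - ε * n.primaryQuarter + if n % 4 = 1 then 0 else α₀.im) :=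
  ((reciprocity hn ho him hc.of_mul_left_right).2 (of_mul_two_pow hn j u ε hc h)).sign_mul ho him

end HasQuarticIndex

/-- The relation between the symbols `(x / π)₄`, `(y / π)₄` for `π = c + d i` and the symbol
`((x + π) / q)₄`, where `c ^ 2 + d ^ 2 = x ^ 2 + 2 q y ^ 2`. -/
theorem HasQuarticIndex.sum_two_sq_relation {c d x y q m y₀ : ℤ} {s v j u ε : ℕ}
    {α : GaussianInt} (hc : Odd c) (hd : d % 4 = 0) (hx : Odd x) (hq : Odd q) (hm : Odd m)
    (hy₀ : Odd y₀) (hcd : c ^ 2 + d ^ 2 = x ^ 2 + 2 * q * y ^ 2) (hxc : x + c = 2 ^ s * m)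
    (hy : y = 2 ^ v * y₀) (ho : Odd (Zsqrtd.norm α)) (him : Even α.im)
    (hα : (⟨x + c, d⟩ : GaussianInt) = 2 ^ j * gaussI ^ u * (1 + gaussI) ^ ε * α)
    (hxy : IsCoprime x y) (hqx : IsCoprime q x) (hqxc : IsCoprime q (x + c))
    (hyxc : IsCoprime y₀ (x + c)) (hdm : IsCoprime d m)
    (hxp : IsCoprime (c ^ 2 + d ^ 2) x) (hyp : IsCoprime (c ^ 2 + d ^ 2) y₀)
    {e X Y κ : ℤ} (h2 : HasQuarticIndex ((2 : ℤ) : GaussianInt) α e)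
    (hX : HasQuarticIndex (x : GaussianInt) ⟨c, d⟩ X)
    (hY : HasQuarticIndex (y₀ : GaussianInt) ⟨c, d⟩ Y)
    (hκ : HasQuarticIndex (⟨x + c, d⟩ : GaussianInt) (q : GaussianInt) κ) :
    (κ - 2 * u * q.primaryQuarter - ε * q.primaryQuarter + (if q % 4 = 1 then 0 else α.im)
      + 2 * v * e + Y - 2 * ε * y₀.primaryQuarter) % 4 =
    (α.im + X - 2 * u * x.primaryQuarter - ε * x.primaryQuarter
      + (if x % 4 = 1 then 0 else α.im) + s * e + 2 * m.primaryQuarter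
      - 2 * u * m.primaryQuarter - ε * m.primaryQuarter
      + (if m % 4 = 1 then 0 else α.im)) % 4 := by
  have hdev : Even d := Int.even_iff.2 (by omega)
  have hπo : Odd (Zsqrtd.norm (⟨c, d⟩ : GaussianInt)) := GaussianInt.odd_norm_mk hc hdev
  have hπn : Zsqrtd.norm (⟨c, d⟩ : GaussianInt) = c ^ 2 + d ^ 2 := by
    rw [Zsqrtd.norm_def]; ring
  have hHn : Zsqrtd.norm (⟨x + c, d⟩ : GaussianInt) = 2 * (x * (x + c)) + q * (2 * y * y) := by
    rw [Zsqrtd.norm_def]; linear_combination hcd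
  have hqα : IsCoprime (⟨x + c, d⟩ : GaussianInt) (q : GaussianInt) := by
    apply GaussianInt.isCoprime_of_norm
    rw [hHn]
    exact IsCoprime.add_mul_left_left
      ((Int.isCoprime_two_left.2 hq).mul_left (hqx.symm.mul_left hqxc.symm)) _
  have hxα : IsCoprime (⟨x + c, d⟩ : GaussianInt) (x : GaussianInt) := by
    apply GaussianInt.isCoprime_of_norm
    rw [hHn, show 2 * (x * (x + c)) + q * (2 * y * y) = q * (2 * y * y) + x * (2 * (x + c)) by ring]
    exact IsCoprime.add_mul_left_left (hqx.mul_left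
      (((Int.isCoprime_two_left.2 hx).mul_left hxy.symm).mul_left hxy.symm)) _
  have hmα : IsCoprime (⟨x + c, d⟩ : GaussianInt) (m : GaussianInt) := by
    apply GaussianInt.isCoprime_of_norm
    rw [Zsqrtd.norm_def, hxc, show 2 ^ s * m * (2 ^ s * m) - -1 * d * d =
      d * d + m * (2 ^ s * (2 ^ s * m)) by ring]
    exact IsCoprime.add_mul_left_left (hdm.mul_left hdm) _
  have hyx : IsCoprime x y₀ := by rw [hy] at hxy; exact hxy.of_mul_right_right
  have hyα : IsCoprime (⟨x + c, d⟩ : GaussianInt) (y₀ : GaussianInt) := by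
    apply GaussianInt.isCoprime_of_norm
    rw [hHn, hy, show q * (2 * (2 ^ v * y₀) * (2 ^ v * y₀)) =
      y₀ * (q * 2 * 2 ^ v * 2 ^ v * y₀) by ring]
    exact IsCoprime.add_mul_left_left
      ((Int.isCoprime_two_left.2 hy₀).mul_left (hyx.mul_left hyxc.symm)) _
  -- the symbols of `q`, `x`, `m` modulo `α`
  have hqo := GaussianInt.odd_norm_intCast hq
  have hxo := GaussianInt.odd_norm_intCast hx
  have hmo := GaussianInt.odd_norm_intCast hm
  have hyo := GaussianInt.odd_norm_intCast hy₀
  have hqi : HasQuarticIndex (q : GaussianInt) α _ :=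
    HasQuarticIndex.reciprocity_of_mul_two_pow ho him hq j u ε (hα ▸ hqα) (hα ▸ hκ)
  have hπx := HasQuarticIndex.reciprocity_of_four_dvd_im hπo hd hx
    (GaussianInt.isCoprime_of_norm (by rwa [hπn])) hX
  -- H ≡ c + di (mod x).
  have hHx : HasQuarticIndex (⟨x + c, d⟩ : GaussianInt) (x : GaussianInt) X :=
    hπx.congr hxo ⟨-1, by rw [GaussianInt.mk_eq, GaussianInt.mk_eq]; push_cast; ring⟩
  have hxi : HasQuarticIndex (x : GaussianInt) α _ :=
    HasQuarticIndex.reciprocity_of_mul_two_pow ho him hx j u ε (hα ▸ hxα) (hα ▸ hHx)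
  -- H ≡ di (mod m), and the rational factor d has symbol 1.
  have hHm : HasQuarticIndex (⟨x + c, d⟩ : GaussianInt) (m : GaussianInt)
      (0 + 2 * m.primaryQuarter) :=
    ((HasQuarticIndex.intCast hm hdm).mul_left (HasQuarticIndex.gaussI_intCast hm) hmo).congr hmo
      ⟨-2 ^ s, by rw [GaussianInt.mk_eq, hxc]; push_cast; ring⟩
  have hmi : HasQuarticIndex (m : GaussianInt) α _ :=
    HasQuarticIndex.reciprocity_of_mul_two_pow ho him hm j u ε (hα ▸ hmα) (hα ▸ hHm)
  -- the symbol of `y₀` modulo `α`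
  have hπy := HasQuarticIndex.reciprocity_of_four_dvd_im hπo hd hy₀
    (GaussianInt.isCoprime_of_norm (by rwa [hπn])) hY
  obtain ⟨Z, hZ⟩ := HasQuarticIndex.exists_of_isCoprime hyo hyα
  have hyi : HasQuarticIndex (y₀ : GaussianInt) α _ :=
    HasQuarticIndex.reciprocity_of_mul_two_pow ho him hy₀ j u ε (hα ▸ hyα) (hα ▸ hZ)
  have hZ2 : (2 * Z) % 4 = Y % 4 := by
    -- Since c² + d² ≡ x² (mod y₀), H² ≡ 2(x + c)(c + di). Only the square of this symbol is needed,
    -- as y occurs squared.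
    have hH : HasQuarticIndex ((⟨x + c, d⟩ : GaussianInt) ^ 2) (y₀ : GaussianInt) (0 + Y) := by
      refine ((HasQuarticIndex.intCast hy₀ ((Int.isCoprime_two_left.2 hy₀).mul_left
        hyxc.symm)).mul_left hπy hyo).congr hyo ⟨((q * 2 * 2 ^ v * 2 ^ v * y₀ : ℤ) : GaussianInt), ?_⟩
      have hZ : ((c ^ 2 + d ^ 2 : ℤ) : GaussianInt) =
          ((x ^ 2 + 2 * q * (2 ^ v * y₀) ^ 2 : ℤ) : GaussianInt) := by rw [hcd, hy]
      have hg := gaussI_sq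
      rw [GaussianInt.mk_eq, GaussianInt.mk_eq]
      push_cast at hZ ⊢
      linear_combination hZ - (d : GaussianInt) ^ 2 * hg
    have := (hZ.pow_left hyo 2).unique hH
    push_cast at this
    omega
  -- the congruence `q y ^ 2 ≡ -x (x + c)` modulo `α`
  have hd2 : α ∣ ((2 : ℤ) : GaussianInt) * ((q * y ^ 2 + x * (x + c) : ℤ) : GaussianInt) := by
    have : ((2 : ℤ) : GaussianInt) * ((q * y ^ 2 + x * (x + c) : ℤ) : GaussianInt) =
        ((Zsqrtd.norm (⟨x + c, d⟩ : GaussianInt) : ℤ) : GaussianInt) := by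
      rw [hHn]; push_cast; ring
    rw [this, Zsqrtd.norm_eq_mul_conj, hα]
    exact Dvd.dvd.mul_right (dvd_mul_left _ _) _
  have hd1 : α ∣ ((q * y ^ 2 + x * (x + c) : ℤ) : GaussianInt) := by
    refine IsCoprime.dvd_of_dvd_mul_left ?_ hd2
    exact GaussianInt.isCoprime_of_norm (Int.isCoprime_two_left.2 ho).symm
  have hL := (hqi.mul_left (((h2.pow_left ho v).mul_left hyi ho).pow_left ho 2) ho)
  have hR := (((HasQuarticIndex.neg_one ho him).mul_left hxi ho).mul_left
    ((h2.pow_left ho s).mul_left hmi ho) ho)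
  have hfin := (hL.congr ho (α' := -1 * (x : GaussianInt) *
    (((2 : ℤ) : GaussianInt) ^ s * (m : GaussianInt))) (by
      have e : (q : GaussianInt) * (((2 : ℤ) : GaussianInt) ^ v * (y₀ : GaussianInt)) ^ 2 -
        -1 * (x : GaussianInt) * (((2 : ℤ) : GaussianInt) ^ s * (m : GaussianInt)) =
          ((q * y ^ 2 + x * (x + c) : ℤ) : GaussianInt) := by
        rw [hxc, hy]; push_cast; ring
      rw [e]; exact hd1)).unique hR
  -- The sign of y₀ drops out because y₀ enters squared and Im α is even.
  have hσ : 2 * (if y₀ % 4 = 1 then 0 else α.im) % 4 = 0 := by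
    obtain ⟨b, hb⟩ := him
    split_ifs <;> omega
  generalize (if y₀ % 4 = 1 then 0 else α.im) = σ at hσ hfin
  push_cast at hfin
  have e1 : 2 * ((v : ℤ) * e + (Z - 2 * u * y₀.primaryQuarter - ε * y₀.primaryQuarter + σ)) =
    2 * v * e + 2 * Z - 4 * (u * y₀.primaryQuarter) - 2 * ε * y₀.primaryQuarter + 2 * σ := by ring
  rw [e1] at hfin
  generalize 2 * (ε : ℤ) * y₀.primaryQuarter = a1 at *
  generalize (u : ℤ) * y₀.primaryQuarter = a2 at *
  generalize 2 * (v : ℤ) * e = a3 at *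
  generalize 2 * (u : ℤ) * q.primaryQuarter = a4 at *
  generalize 2 * (u : ℤ) * x.primaryQuarter = a5 at *
  generalize 2 * (u : ℤ) * m.primaryQuarter = a6 at *
  generalize (ε : ℤ) * q.primaryQuarter = a7 at *
  generalize (ε : ℤ) * x.primaryQuarter = a8 at *
  generalize (ε : ℤ) * m.primaryQuarter = a9 at *
  generalize (s : ℤ) * e = a10 at *
  omega

/-! ### Congruences for the indices, by the powers of 2 in x + c, d and y -/

theorem Int.primaryQuarter_cases {m : ℤ} (hm : Odd m) :
    (m % 4 = 1 ∧ m = 1 + 4 * m.primaryQuarter) ∨ (m % 4 = 3 ∧ m = -(1 + 4 * m.primaryQuarter)) := by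
  have h := Int.primarySign_eq hm
  unfold Int.primarySign at h
  obtain ⟨k, hk⟩ := hm
  split_ifs at h <;> omega

theorem Int.sq_emod_two (a : ℤ) : a ^ 2 % 2 = a % 2 := by
  rcases Int.even_or_odd' a with ⟨k, rfl | rfl⟩ <;> ring_nf <;> omega

theorem Int.exists_sq_eq_of_odd {a : ℤ} (ha : Odd a) : ∃ t, a ^ 2 = 8 * t + 1 := by
  obtain ⟨k, rfl⟩ := ha
  obtain ⟨t, ht⟩ := Int.even_mul_succ_self k
  exact ⟨t, by linear_combination 4 * ht⟩

section Arithmetic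

variable {c c' m m' q q' δ w v κ X Y : ℤ}

/-- Case x + c = 2m: α = m + 2δi, with index mδ for 2. In this section d = 4δ, y = 2w, and `hrel`
comes from equating the two representations of p. -/
theorem quarticIndex_arith_two_exact (hc : c = 1 + 4 * c')
    (hm : (m % 4 = 1 ∧ m = 1 + 4 * m') ∨ (m % 4 = 3 ∧ m = -(1 + 4 * m')))
    (hq : (q % 4 = 1 ∧ q = 1 + 4 * q') ∨ (q % 4 = 3 ∧ q = -(1 + 4 * q')))
    (hrel : m * (m - c) = 4 * δ ^ 2 - 2 * q * w ^ 2)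
    (h : (κ + (if q % 4 = 1 then 0 else 2 * δ) + 2 * v * (m * δ) + Y) % 4 =
      (2 * δ + X + m * δ + 2 * m' + (if m % 4 = 1 then 0 else 2 * δ)) % 4) :
    (X - Y - κ) % 4 = (2 * q' + 2 * ((m - 2 * c') * q') + 2 * (if q % 4 = 1 then δ + w else 0) +
      2 * v * δ + δ + 2 * c') % 4 := by
  have hδ := Int.sq_emod_two δ
  rcases Int.even_or_odd' w with ⟨t, ht | ht⟩ <;>
  rcases hm with ⟨hm4, hm⟩ | ⟨hm4, hm⟩ <;> rcases hq with ⟨hq4, hq⟩ | ⟨hq4, hq⟩ <;>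
    simp only [hm4, hq4, if_true, reduceIte,
      show ¬ ((3 : ℤ) = 1) by norm_num] at h ⊢ <;> clear hm4 hq4 <;> subst hc hm hq ht <;>
    ring_nf at hrel h ⊢ <;> omega

variable {d₀ e g n y₀ E N N' a s x' y' ρ ρ' D : ℤ}

/-- Case x + c = 4m, y = 2y₀ and 8 ∣ d: α = m + δi. -/
theorem quarticIndex_arith_four_exact (hc : c = 1 + 4 * c')
    (hm : (m % 4 = 1 ∧ m = 1 + 4 * m') ∨ (m % 4 = 3 ∧ m = -(1 + 4 * m')))
    (hq : (q % 4 = 1 ∧ q = 1 + 4 * q') ∨ (q % 4 = 3 ∧ q = -(1 + 4 * q')))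
    (hy₀ : Odd y₀) (hrel : m * (c - 2 * m) = q * y₀ ^ 2 - 8 * N) (hδ : δ = 2 * E) (hw : w = y₀)
    (h : (κ + (if q % 4 = 1 then 0 else δ) + 2 * e + Y) % 4 =
      (δ + X + δ + 2 * e + 2 * m' + (if m % 4 = 1 then 0 else δ)) % 4) (hv : v = 1) :
    (X - Y - κ) % 4 = (2 * q' + 2 * (2 * g * q') + 2 * (if q % 4 = 1 then δ + w else 0) +
      2 * v * δ + δ + 2 * c') % 4 := by
  obtain ⟨t, rfl⟩ := hy₀
  have hE := Int.even_mul_succ_self t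
  obtain ⟨k, hk⟩ := hE
  have hsq : (2 * t + 1) ^ 2 = 8 * k + 1 := by linear_combination 4 * hk
  rw [hsq] at hrel
  clear hsq hk
  rcases hm with ⟨hm4, hm⟩ | ⟨hm4, hm⟩ <;> rcases hq with ⟨hq4, hq⟩ | ⟨hq4, hq⟩ <;>
    simp only [hm4, hq4, if_true, reduceIte,
      show ¬ ((3 : ℤ) = 1) by norm_num] at h ⊢ <;> clear hm4 hq4 <;> subst hc hm hq hw hδ hv <;>
    ring_nf at hrel h ⊢ <;> omega

/-- Case 16 ∣ x + c with d divisible by a higher power of 2 than x + c: α = m + ai. -/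
theorem quarticIndex_arith_sixteen_dvd (hc : c = 1 + 4 * c')
    (hm : (m % 4 = 1 ∧ m = 1 + 4 * m') ∨ (m % 4 = 3 ∧ m = -(1 + 4 * m')))
    (hq : (q % 4 = 1 ∧ q = 1 + 4 * q') ∨ (q % 4 = 3 ∧ q = -(1 + 4 * q')))
    (hy₀ : Odd y₀) (hrel : m * (c - 8 * N') = q * y₀ ^ 2 - 8 * N) (hδ : δ = 4 * d₀)
    (hw : w = 2 * n) (hE : a = 2 * E)
    (h : (κ + (if q % 4 = 1 then 0 else a) + 2 * v * e + Y) % 4 =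
      (a + X + a + 2 * v * e + 2 * m' + (if m % 4 = 1 then 0 else a)) % 4) :
    (X - Y - κ) % 4 = (2 * q' + 2 * (2 * g * q') + 2 * (if q % 4 = 1 then δ + w else 0) +
      2 * v * δ + δ + 2 * c') % 4 := by
  obtain ⟨t, ht⟩ := Int.exists_sq_eq_of_odd hy₀
  rw [ht] at hrel
  clear ht hy₀
  rcases hm with ⟨hm4, hm⟩ | ⟨hm4, hm⟩ <;> rcases hq with ⟨hq4, hq⟩ | ⟨hq4, hq⟩ <;>
    simp only [hm4, hq4, if_true, reduceIte,
      show ¬ ((3 : ℤ) = 1) by norm_num] at h ⊢ <;> clear hm4 hq4 <;> subst hc hm hq hw hδ hE <;>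
    ring_nf at hrel h ⊢ <;> omega

/-- Case d = 8d₀ and x + c = 16m: α = d₀ + ai, with the unit i taken out of H. -/
theorem quarticIndex_arith_eight_exact (hc : c = 1 + 4 * c')
    (hm : (m % 4 = 1 ∧ m = 1 + 4 * m') ∨ (m % 4 = 3 ∧ m = -(1 + 4 * m')))
    (hq : (q % 4 = 1 ∧ q = 1 + 4 * q') ∨ (q % 4 = 3 ∧ q = -(1 + 4 * q')))
    (hy₀ : Odd y₀) (hd₀ : Odd d₀) (hrel : m * (c - 8 * N) = q * y₀ ^ 2 - 2 * d₀ ^ 2)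
    (hδ : δ = 2 * d₀) (hw : w = 2 * n) (hE : a = -(2 * m)) (hx' : x' = c' - 4 * N')
    (h : (κ - 2 * q' + (if q % 4 = 1 then 0 else a) + 2 * v * e + Y) % 4 =
      (a + X - 2 * x' + a + 2 * v * e + 2 * m' - 2 * m' + (if m % 4 = 1 then 0 else a)) % 4) :
    (X - Y - κ) % 4 = (2 * q' + 2 * (2 * g * q') + 2 * (if q % 4 = 1 then δ + w else 0) +
      2 * v * δ + δ + 2 * c') % 4 := by
  obtain ⟨t, ht⟩ := Int.exists_sq_eq_of_odd hy₀
  obtain ⟨t', ht'⟩ := Int.exists_sq_eq_of_odd hd₀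
  obtain ⟨D, rfl⟩ := hd₀
  rw [ht, ht'] at hrel
  clear ht hy₀ ht'
  rcases hm with ⟨hm4, hm⟩ | ⟨hm4, hm⟩ <;> rcases hq with ⟨hq4, hq⟩ | ⟨hq4, hq⟩ <;>
    simp only [hm4, hq4, if_true, reduceIte,
      show ¬ ((3 : ℤ) = 1) by norm_num] at h ⊢ <;> clear hm4 hq4 <;> subst hc hm hq hw hδ hE hx' <;>
    ring_nf at hrel h ⊢ <;> omega

/-- Case 16 ∣ d with d less divisible by 2 than x + c, where x + c has an even exponent of 2. If 4 ∣
a the sign terms vanish; if a = -2m they are controlled by `hrel`. -/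
theorem quarticIndex_arith_large (hc : c = 1 + 4 * c')
    (hm : (m % 4 = 1 ∧ m = 1 + 4 * m') ∨ (m % 4 = 3 ∧ m = -(1 + 4 * m')))
    (hq : (q % 4 = 1 ∧ q = 1 + 4 * q') ∨ (q % 4 = 3 ∧ q = -(1 + 4 * q')))
    (hrel : a = -(2 * m) ∧ m * (c - 8 * N) = q * y₀ ^ 2 - 4 * D ∨ a = 4 * E) (hy₀ : Odd y₀)
    (hδ : δ = 4 * d₀) (hw : w = 2 * n) (hx' : x' = c' - 4 * N')
    (h : (κ - 2 * q' + (if q % 4 = 1 then 0 else a) + 2 * v * e + Y) % 4 =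
      (a + X - 2 * x' + a + 2 * v * e + 2 * m' - 2 * m' + (if m % 4 = 1 then 0 else a)) % 4) :
    (X - Y - κ) % 4 = (2 * q' + 2 * (2 * g * q') + 2 * (if q % 4 = 1 then δ + w else 0) +
      2 * v * δ + δ + 2 * c') % 4 := by
  rcases hrel with ⟨hE, hrel⟩ | hE
  · obtain ⟨t, ht⟩ := Int.exists_sq_eq_of_odd hy₀
    rw [ht] at hrel
    clear ht hy₀
    rcases hm with ⟨hm4, hm⟩ | ⟨hm4, hm⟩ <;> rcases hq with ⟨hq4, hq⟩ | ⟨hq4, hq⟩ <;>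
      simp only [hm4, hq4, if_true, reduceIte,
        show ¬ ((3 : ℤ) = 1) by norm_num] at h ⊢ <;> clear hm4 hq4 <;> subst hc hm hq hw hδ hE hx' <;>
      ring_nf at hrel h ⊢ <;> omega
  · rcases hm with ⟨hm4, hm⟩ | ⟨hm4, hm⟩ <;> rcases hq with ⟨hq4, hq⟩ | ⟨hq4, hq⟩ <;>
      simp only [hm4, hq4, if_true, reduceIte,
        show ¬ ((3 : ℤ) = 1) by norm_num] at h ⊢ <;> clear hm4 hq4 <;>
      subst hc hm hq hw hδ hE hx' <;> ring_nf at h ⊢ <;> omega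

/-- Case of equal powers of 2 in x + c and d, where H contains 1 + i. The quarters q', x', m' then
enter undoubled, so `hrel` is needed modulo 16. -/
theorem quarticIndex_arith_eq_of_one (hc : c = 1 + 4 * c') (hm4 : m % 4 = 1) (hm : m = 1 + 4 * m')
    (hq : (q % 4 = 1 ∧ q = 1 + 4 * q') ∨ (q % 4 = 3 ∧ q = -(1 + 4 * q')))
    (hy : y₀ = 1 + 4 * y' ∨ y₀ = -(1 + 4 * y')) (hrel : m * c = q * y₀ ^ 2 + 16 * N)
    (hd₀ : d₀ = 1 + 4 * D) (hx' : x' = c' - ρ * m) (hδ : δ = ρ * d₀)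
    (hρ : (ρ = 1 ∧ v = 1 ∧ w = y₀) ∨ (ρ = 4 * n ∧ w = 2 * N')) (hE : a = 2 * E)
    (h : (κ - q' + (if q % 4 = 1 then 0 else a) + 2 * v * e + Y - 2 * y') % 4 =
      (a + X - x' + a + 2 * v * e + 2 * m' - m' + (if m % 4 = 1 then 0 else a)) % 4) :
    (X - Y - κ) % 4 = (2 * q' + 2 * (2 * g * q') + 2 * (if q % 4 = 1 then δ + w else 0) +
      2 * v * δ + δ + 2 * c') % 4 := by
  have hy2 : y₀ ^ 2 = 1 + 8 * y' + 16 * y' ^ 2 := by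
    rcases hy with rfl | rfl <;> ring
  rw [hy2] at hrel
  rcases hρ with ⟨hρ, hv, hw⟩ | ⟨hρ, hw⟩ <;> rcases hq with ⟨hq4, hq⟩ | ⟨hq4, hq⟩ <;>
    simp only [hm4, hq4, if_true, reduceIte, show ¬ ((3 : ℤ) = 1) by norm_num] at h ⊢ <;>
    clear hm4 hq4 <;> subst hδ hρ hd₀ hc hm hq hE hx' <;> ring_nf at hrel h ⊢ <;> omega

theorem quarticIndex_arith_eq_of_three (hc : c = 1 + 4 * c') (hm4 : m % 4 = 3)
    (hm : m = -(1 + 4 * m'))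
    (hq : (q % 4 = 1 ∧ q = 1 + 4 * q') ∨ (q % 4 = 3 ∧ q = -(1 + 4 * q')))
    (hy : y₀ = 1 + 4 * y' ∨ y₀ = -(1 + 4 * y')) (hrel : m * c = q * y₀ ^ 2 + 16 * N)
    (hd₀ : d₀ = 1 + 4 * D) (hx' : x' = c' - ρ * m) (hδ : δ = ρ * d₀)
    (hρ : (ρ = 1 ∧ v = 1 ∧ w = y₀) ∨ (ρ = 4 * n ∧ w = 2 * N')) (hE : a = 2 * E)
    (h : (κ - 2 * q' - q' + (if q % 4 = 1 then 0 else a) + 2 * v * e + Y - 2 * y') % 4 =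
      (a + X - 2 * x' - x' + a + 2 * v * e + 2 * m' - 2 * m' - m' +
        (if m % 4 = 1 then 0 else a)) % 4) :
    (X - Y - κ) % 4 = (2 * q' + 2 * (2 * g * q') + 2 * (if q % 4 = 1 then δ + w else 0) +
      2 * v * δ + δ + 2 * c') % 4 := by
  have hy2 : y₀ ^ 2 = 1 + 8 * y' + 16 * y' ^ 2 := by
    rcases hy with rfl | rfl <;> ring
  rw [hy2] at hrel
  rcases hρ with ⟨hρ, hv, hw⟩ | ⟨hρ, hw⟩ <;> rcases hq with ⟨hq4, hq⟩ | ⟨hq4, hq⟩ <;>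
    simp only [hm4, hq4, if_true, reduceIte, show ¬ ((3 : ℤ) = 1) by norm_num] at h ⊢ <;>
    clear hm4 hq4 <;> subst hδ hρ hd₀ hc hm hq hE hx' <;> ring_nf at hrel h ⊢ <;> omega

/-- Case of an odd exponent s ≥ 3 of 2 in x + c. The symbol of 2 modulo α does not cancel, so its
value e is used. -/
theorem quarticIndex_arith_odd
    (hm : (m % 4 = 1 ∧ m = 1 + 4 * m') ∨ (m % 4 = 3 ∧ m = -(1 + 4 * m')))
    (hq : (q % 4 = 1 ∧ q = 1 + 4 * q') ∨ (q % 4 = 3 ∧ q = -(1 + 4 * q')))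
    (hd₀ : d₀ = 1 + 4 * D) (hx' : x' = c' - 2 * N) (hδ : δ = ρ * d₀)
    (hρ : ρ = 1 ∨ ρ = 2 * n) (hw : w = 2 * N') (hE : a = -(2 * ρ * m)) (he : e = -(m * δ))
    (hs : s = 2 * (ρ' + 2) - 1) (hρ' : ρ = 1 → ρ' = 0)
    (h : (κ - 2 * q' + (if q % 4 = 1 then 0 else a) + 2 * v * e + Y) % 4 =
      (a + X - 2 * x' + a + s * e + 2 * m' - 2 * m' + (if m % 4 = 1 then 0 else a)) % 4) :
    (X - Y - κ) % 4 = (2 * q' + 2 * (2 * g * q') + 2 * (if q % 4 = 1 then δ + w else 0) +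
      2 * v * δ + δ + 2 * c') % 4 := by
  rcases hρ with hρ | hρ
  · have hρ0 := hρ' hρ
    clear hρ'
    rcases hm with ⟨hm4, hm⟩ | ⟨hm4, hm⟩ <;> rcases hq with ⟨hq4, hq⟩ | ⟨hq4, hq⟩ <;>
      simp only [hm4, hq4, if_true, reduceIte, show ¬ ((3 : ℤ) = 1) by norm_num] at h ⊢ <;>
      clear hm4 hq4 <;> subst hρ0 he hs hδ hE hρ hd₀ hm hq hx' hw <;> ring_nf at h ⊢ <;> omega
  · clear hρ'
    rcases hm with ⟨hm4, hm⟩ | ⟨hm4, hm⟩ <;> rcases hq with ⟨hq4, hq⟩ | ⟨hq4, hq⟩ <;>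
      simp only [hm4, hq4, if_true, reduceIte, show ¬ ((3 : ℤ) = 1) by norm_num] at h ⊢ <;>
      clear hm4 hq4 <;> subst he hs hδ hE hρ hd₀ hm hq hx' hw <;> ring_nf at h ⊢ <;> omega

end Arithmetic

/-! ### Powers of 2 and coprimality -/

theorem Int.two_pow_mul_odd_inj {a b : ℕ} {A B : ℤ} (hA : Odd A) (hB : Odd B)
    (h : 2 ^ a * A = 2 ^ b * B) : a = b ∧ A = B := by
  have key : ∀ {a b : ℕ} {A B : ℤ}, Odd A → 2 ^ a * A = 2 ^ b * B → b ≤ a := by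
    intro a b A B hA h
    by_contra hab
    obtain ⟨k, rfl⟩ := Nat.exists_eq_add_of_lt (not_le.1 hab)
    have : A = 2 * (2 ^ k * B) := by
      apply mul_left_cancel₀ (pow_ne_zero a (two_ne_zero (α := ℤ)))
      rw [h]; ring
    rw [this] at hA
    exact Int.not_even_iff_odd.2 hA (even_two_mul _)
  obtain rfl := le_antisymm (key hB h.symm) (key hA h)
  exact ⟨rfl, mul_left_cancel₀ (pow_ne_zero a (two_ne_zero (α := ℤ))) h⟩

theorem Int.exists_eq_two_pow_mul_odd {n : ℤ} (hn : n ≠ 0) :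
    ∃ (k : ℕ) (m : ℤ), Odd m ∧ n = 2 ^ k * m := by
  obtain ⟨k, m, hm, h⟩ := Nat.exists_eq_two_pow_mul_odd (Int.natAbs_ne_zero.2 hn)
  rcases Int.natAbs_eq n with h' | h'
  · exact ⟨k, m, (Int.odd_coe_nat m).2 hm, by rw [h', h]; push_cast; ring⟩
  · exact ⟨k, -m, ((Int.odd_coe_nat m).2 hm).neg, by rw [h', h]; push_cast; ring⟩

section Coprimality

variable {p : ℕ} (hp : p.Prime) {c d x y q : ℤ} (hcd : (p : ℤ) = c ^ 2 + d ^ 2)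
  (hxy : (p : ℤ) = x ^ 2 + 2 * q * y ^ 2)

include hp hxy

/-- A common prime of x and y divides p, hence is p up to sign, and then p² would divide p. -/
theorem isCoprime_of_eq_sq_add_two_mul_mul_sq : IsCoprime x y := by
  have hpp : Prime (p : ℤ) := Nat.prime_iff_prime_int.1 hp
  refine isCoprime_of_prime_dvd ?_ ?_
  · rintro ⟨rfl, rfl⟩
    exact hpp.ne_zero (by rw [hxy]; ring)
  · intro z hz hzx hzy
    have hzp : z ∣ p := by
      rw [hxy]
      exact dvd_add (dvd_pow hzx two_ne_zero) (dvd_mul_of_dvd_right (dvd_pow hzy two_ne_zero) _)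
    have hass := (hz.associated_of_dvd hpp hzp).symm
    obtain ⟨a, ha⟩ := hass.dvd.trans hzx
    obtain ⟨b, hb⟩ := hass.dvd.trans hzy
    apply hpp.not_isUnit
    refine IsUnit.of_mul_eq_one (a ^ 2 + 2 * q * b ^ 2) ?_
    apply mul_left_cancel₀ hpp.ne_zero
    rw [mul_one]
    conv_rhs => rw [hxy, ha, hb]
    ring

theorem isCoprime_left_of_eq_sq_add_two_mul_mul_sq (hpq : ¬ (p : ℤ) ∣ q) : IsCoprime q x := by
  have hpp : Prime (p : ℤ) := Nat.prime_iff_prime_int.1 hp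
  refine isCoprime_of_prime_dvd ?_ ?_
  · rintro ⟨rfl, -⟩
    exact hpq (dvd_zero _)
  · intro z hz hzq hzx
    have hzp : z ∣ p := by
      rw [hxy]
      exact dvd_add (dvd_pow hzx two_ne_zero)
        (dvd_mul_of_dvd_left (dvd_mul_of_dvd_right hzq _) _)
    exact hpq ((hz.associated_of_dvd hpp hzp).symm.dvd.trans hzq)

/-- As p does not divide 2q, it divides x if and only if it divides y, and x, y are coprime. -/
theorem isCoprime_prime_of_eq_sq_add_two_mul_mul_sq (hp2 : p ≠ 2) (hpq : ¬ (p : ℤ) ∣ q) :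
    IsCoprime (p : ℤ) x ∧ IsCoprime (p : ℤ) y := by
  have hpp : Prime (p : ℤ) := Nat.prime_iff_prime_int.1 hp
  have hc := isCoprime_of_eq_sq_add_two_mul_mul_sq hp hxy
  have hp2' : ¬ (p : ℤ) ∣ 2 := by
    intro h
    exact hp2 ((Nat.prime_dvd_prime_iff_eq hp Nat.prime_two).1 (by exact_mod_cast h))
  have hiff : (p : ℤ) ∣ x ↔ (p : ℤ) ∣ y := by
    constructor
    · intro h
      have h1 : (p : ℤ) ∣ 2 * q * y ^ 2 := by
        rw [← dvd_add_right (dvd_pow h two_ne_zero), ← hxy]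
      rcases hpp.dvd_or_dvd h1 with h1 | h1
      · exact ((hpp.dvd_or_dvd h1).elim hp2' hpq).elim
      · exact hpp.dvd_of_dvd_pow h1
    · intro h
      have h1 : (p : ℤ) ∣ x ^ 2 := by
        rw [← dvd_add_left (dvd_mul_of_dvd_right (dvd_pow h two_ne_zero) (2 * q)), ← hxy]
      exact hpp.dvd_of_dvd_pow h1
  have hx : ¬ (p : ℤ) ∣ x := fun h => hpp.not_isUnit (hc.isUnit_of_dvd' h (hiff.1 h))
  exact ⟨(Prime.coprime_iff_not_dvd hpp).2 hx,
    (Prime.coprime_iff_not_dvd hpp).2 (fun h => hx (hiff.2 h))⟩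

end Coprimality

theorem Prime.not_dvd_two_of_dvd_odd {z n : ℤ} (hz : Prime z) (hn : Odd n) (h : z ∣ n) :
    ¬ z ∣ 2 := fun h2 => hz.not_isUnit ((Int.isCoprime_two_left.2 hn).isUnit_of_dvd' h2 h)

/-- The odd divisors of `n` are prime to `x + c` if they divide `d ^ 2` modulo `x + c`. -/
theorem isCoprime_of_dvd_sq {n d d₀ e : ℤ} {r : ℕ} (hn : Odd n) (hd : d = 2 ^ r * d₀)
    (hgcd : IsCoprime d₀ e) (h : ∃ a b, d ^ 2 = n * a + e * b) : IsCoprime n e := by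
  refine isCoprime_of_prime_dvd ?_ ?_
  · rintro ⟨rfl, -⟩; simp at hn
  · intro z hz hzn hze
    obtain ⟨a, b, hab⟩ := h
    have h2 := hz.not_dvd_two_of_dvd_odd hn hzn
    have hzd : z ∣ d ^ 2 := by
      rw [hab]
      exact dvd_add (dvd_mul_of_dvd_left hzn a) (dvd_mul_of_dvd_left hze b)
    have hzd' := hz.dvd_of_dvd_pow hzd
    rw [hd] at hzd'
    rcases hz.dvd_or_dvd hzd' with h' | h'
    · exact h2 (hz.dvd_of_dvd_pow h')
    · exact hz.not_isUnit (hgcd.isUnit_of_dvd' h' hze)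

/-! ### The explicit relation for p -/

theorem HasQuarticIndex.exists_two {α : GaussianInt} (ho : Odd (Zsqrtd.norm α)) :
    ∃ e, HasQuarticIndex ((2 : ℤ) : GaussianInt) α e :=
  exists_of_isCoprime ho
    (GaussianInt.isCoprime_of_norm (Int.isCoprime_two_left.2 ho).symm).symm

/-- The shifts r' + 2 and v' + 1 encode 4 ∣ d and 2 ∣ y. For each pattern of powers of 2, H is
factored explicitly and the general relation evaluated. -/
theorem HasQuarticIndex.relation_of_prime {p : ℕ} (hp : p.Prime) {c d x y q d₀ y₀ : ℤ} {r' v' : ℕ}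
    (hcd : (p : ℤ) = c ^ 2 + d ^ 2) (hxy : (p : ℤ) = x ^ 2 + 2 * q * y ^ 2) (hc : c % 4 = 1)
    (hd : d = 2 ^ (r' + 2) * d₀) (hd₀ : d₀ % 4 = 1) (hq : Odd q) (hpq : ¬ (p : ℤ) ∣ q)
    (hx : Odd x) (hy : y = 2 ^ (v' + 1) * y₀) (hy₀ : Odd y₀) (hgcd : IsCoprime d₀ (x + c))
    (hxc0 : x + c ≠ 0) {X Y κ : ℤ} (hX : HasQuarticIndex (x : GaussianInt) ⟨c, d⟩ X)
    (hY : HasQuarticIndex (y₀ : GaussianInt) ⟨c, d⟩ Y)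
    (hκ : HasQuarticIndex (⟨x + c, d⟩ : GaussianInt) (q : GaussianInt) κ) :
    (X - Y - κ) % 4 = (2 * q.primaryQuarter + 2 * ((x + 1) / 2 * q.primaryQuarter) +
      2 * (if q % 4 = 1 then 2 ^ r' * d₀ + 2 ^ v' * y₀ else 0) +
      2 * ((v' + 1 : ℕ) : ℤ) * (2 ^ r' * d₀) + 2 ^ r' * d₀ + 2 * ((c - 1) / 4)) % 4 := by
  obtain ⟨s, m, hm, hxc⟩ := Int.exists_eq_two_pow_mul_odd hxc0
  have hcodd : Odd c := Int.odd_iff.2 (by omega)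
  have hd₀odd : Odd d₀ := Int.odd_iff.2 (by omega)
  have hd' : d = 4 * (2 ^ r' * d₀) := by rw [hd]; ring
  have hd4 : d % 4 = 0 := by rw [hd']; omega
  have hp2 : p ≠ 2 := by
    rintro rfl
    have h1 : Odd (c ^ 2 + d ^ 2) := by
      refine hcodd.pow.add_even ?_
      rw [hd']; exact ⟨8 * (2 ^ r' * d₀) ^ 2, by ring⟩
    rw [← hcd] at h1
    exact absurd h1 (by decide)
  have hyx := isCoprime_of_eq_sq_add_two_mul_mul_sq hp hxy
  have hqx := isCoprime_left_of_eq_sq_add_two_mul_mul_sq hp hxy hpq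
  obtain ⟨hpx, hpy⟩ := isCoprime_prime_of_eq_sq_add_two_mul_mul_sq hp hxy hp2 hpq
  have hsq : c ^ 2 + d ^ 2 = x ^ 2 + 2 * q * y ^ 2 := by rw [← hcd, hxy]
  -- d² = 2qy² + (x + c)(x - c), so a common prime of q and x + c divides d₀.
  have hqxc : IsCoprime q (x + c) := isCoprime_of_dvd_sq hq hd hgcd
    ⟨2 * y ^ 2, x - c, by linear_combination hsq⟩
  have hyxc : IsCoprime y₀ (x + c) := isCoprime_of_dvd_sq hy₀ hd hgcd
    ⟨2 * q * 2 ^ (v' + 1) * 2 ^ (v' + 1) * y₀, x - c, by rw [hy] at hsq; linear_combination hsq⟩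
  have hd₀m : IsCoprime d₀ m := by rw [hxc] at hgcd; exact hgcd.of_mul_right_right
  have hdm : IsCoprime d m := by
    rw [hd]
    exact ((Int.isCoprime_two_left.2 hm).pow_left).mul_left hd₀m
  have hpy₀ : IsCoprime (p : ℤ) y₀ := by rw [hy] at hpy; exact hpy.of_mul_right_right
  have hcc : c = 1 + 4 * ((c - 1) / 4) := by omega
  have hmc := Int.primaryQuarter_cases hm
  have hqc := Int.primaryQuarter_cases hq
  have hmain : ∀ (j u ε : ℕ) (a b e : ℤ), Odd a → Even b →
      (⟨x + c, d⟩ : GaussianInt) = 2 ^ j * gaussI ^ u * (1 + gaussI) ^ ε * ⟨a, b⟩ →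
      HasQuarticIndex ((2 : ℤ) : GaussianInt) ⟨a, b⟩ e → _ := fun j u ε a b e ha hb hα h2 =>
    HasQuarticIndex.sum_two_sq_relation (s := s) (v := v' + 1) (j := j) (u := u) (ε := ε)
      hcodd hd4 hx hq hm hy₀ hsq hxc hy (GaussianInt.odd_norm_mk ha hb) hb hα hyx hqx hqxc hyxc
      hdm (hcd ▸ hpx) (hcd ▸ hpy₀) h2 hX hY hκ
  obtain ⟨δ, hδ⟩ : ∃ δ, δ = 2 ^ r' * d₀ := ⟨_, rfl⟩
  obtain ⟨w, hw⟩ : ∃ w, w = 2 ^ v' * y₀ := ⟨_, rfl⟩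
  have hyw : y = 2 * w := by rw [hy, hw]; ring
  rw [← hδ] at hd' ⊢
  rw [← hw]
  rcases s with _ | _ | s'
  · exfalso
    rw [pow_zero, one_mul] at hxc
    obtain ⟨k, rfl⟩ := hx
    obtain ⟨l, rfl⟩ := hm
    omega
  · rw [zero_add, pow_one] at hxc
    have hδm : IsCoprime m (2 * δ) := by
      rw [hd', show 4 * δ = 2 * (2 * δ) by ring] at hdm
      exact hdm.of_mul_left_right.symm
    have hα : (⟨x + c, d⟩ : GaussianInt) =
        2 ^ 1 * gaussI ^ 0 * (1 + gaussI) ^ 0 * ⟨m, 2 * δ⟩ := by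
      rw [GaussianInt.mk_eq, GaussianInt.mk_eq, hxc, hd']
      push_cast; ring
    have core := hmain 1 0 0 m (2 * δ) _ hm (even_two_mul δ) hα
      (HasQuarticIndex.two_mk hm (even_two_mul δ) hδm)
    have hx4 : x % 4 = 1 := by obtain ⟨l, rfl⟩ := hm; omega
    rw [Int.mul_ediv_cancel_left _ two_ne_zero] at core
    rw [if_pos hx4] at core
    rw [show (x + 1) / 2 = m - 2 * ((c - 1) / 4) by omega]
    refine quarticIndex_arith_two_exact hcc hmc hqc ?_ ?_
    · obtain rfl : x = 2 * m - c := by linarith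
      rw [hd', hyw] at hsq
      linarith
    · convert core using 2 <;> push_cast <;> ring
  -- now `4 ∣ x + c`
  have hxc4 : x = 4 * (2 ^ s' * m) - c := by rw [← eq_sub_iff_add_eq] at hxc; rw [hxc]; ring
  have hx4 : x % 4 = 3 := by omega
  have hx1 : ¬ x % 4 = 1 := by omega
  obtain ⟨x', hx'⟩ : ∃ x', x' = x.primaryQuarter := ⟨_, rfl⟩
  have hx'' : x' = (c - 1) / 4 - 2 ^ s' * m := by
    have := Int.primaryQuarter_cases hx
    rw [← hx'] at this
    omega
  -- (x + 1)/2 is even from here on; half of it is the free variable `g` of the congruence lemmas.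
  rw [show (x + 1) / 2 = 2 * (2 ^ s' * m - (c - 1) / 4) by omega]
  simp only [if_neg hx1, ← hx'] at hmain
  -- This is the equality of the two representations of p, divided by 8. The exponents 2v' and 2r' +
  -- 1 differ, so s' is the smaller one.
  have hrel : 2 ^ s' * (m * (c - 2 * 2 ^ s' * m)) = 2 ^ (2 * v') * (q * y₀ ^ 2) -
      2 ^ (2 * r' + 1) * d₀ ^ 2 := by
    rw [hd', hyw, hδ, hw, hxc4] at hsq
    have e1 : (2 : ℤ) ^ (2 * v') = 2 ^ v' * 2 ^ v' := by ring
    have e2 : (2 : ℤ) ^ (2 * r' + 1) = 2 * (2 ^ r' * 2 ^ r') := by ring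
    rw [e1, e2]
    apply mul_left_cancel₀ (show (8 : ℤ) ≠ 0 by norm_num)
    linear_combination hsq
  have hodd1 : Odd (m * (c - 2 * 2 ^ s' * m)) :=
    hm.mul (hcodd.sub_even ⟨2 ^ s' * m, by ring⟩)
  have hodd2 : Odd (q * y₀ ^ 2) := hq.mul hy₀.pow
  have hodd3 : Odd (d₀ ^ 2) := hd₀odd.pow
  rcases Nat.lt_or_ge r' v' with hvr | hvr
  · obtain ⟨l, rfl⟩ := Nat.exists_eq_add_of_lt hvr
    have hrel' : 2 ^ s' * (m * (c - 2 * 2 ^ s' * m)) =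
        2 ^ (2 * r' + 1) * (2 * (2 ^ (2 * l) * (q * y₀ ^ 2)) - d₀ ^ 2) := by
      rw [hrel]; ring
    obtain ⟨rfl, -⟩ := Int.two_pow_mul_odd_inj hodd1 ((even_two_mul _).sub_odd hodd3) hrel'
    have ha : Even (-(2 * (2 ^ r' * m))) := (even_two_mul _).neg
    have h2d₀ := (Int.isCoprime_two_left.2 hd₀odd).symm
    have hcop : IsCoprime d₀ (-(2 * (2 ^ r' * m))) :=
      (h2d₀.mul_right (h2d₀.pow_right.mul_right hd₀m)).neg_right
    have hα : (⟨x + c, d⟩ : GaussianInt) =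
        2 ^ (r' + 2) * gaussI ^ 1 * (1 + gaussI) ^ 0 * ⟨d₀, -(2 * (2 ^ r' * m))⟩ := by
      rw [GaussianInt.mk_eq, GaussianInt.mk_eq, hxc, hd]
      push_cast
      linear_combination (2 ^ (2 * r' + 3) * m : GaussianInt) * gaussI_sq
    have core := hmain (r' + 2) 1 0 d₀ _ _ hd₀odd ha hα (HasQuarticIndex.two_mk hd₀odd ha hcop)
    refine quarticIndex_arith_odd (d₀ := d₀) (D := (d₀ - 1) / 4) (N := 2 ^ (2 * r') * m)
      (ρ := 2 ^ r') (n := 2 ^ (r' - 1)) (N' := 2 ^ (r' + l) * y₀) (ρ' := r') hmc hqc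
      (by omega) (hx''.trans (by ring)) hδ ?_ (hw.trans (by ring)) rfl (e := -(m * δ)) rfl rfl ?_ ?_
    · rcases Nat.eq_zero_or_pos r' with rfl | h0
      · exact Or.inl (pow_zero _)
      · exact Or.inr (by rw [← pow_succ', Nat.sub_add_cancel h0])
    · intro h
      rcases Nat.eq_zero_or_pos r' with rfl | h0
      · rfl
      · exact absurd h (one_lt_pow₀ (by norm_num : (1 : ℤ) < 2) h0.ne').ne'
    · rw [show d₀ * (-(2 * (2 ^ r' * m)) / 2) = -(m * δ) by
        rw [show -(2 * (2 ^ r' * m)) / 2 = -(2 ^ r' * m) by omega, hδ]; ring] at core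
      convert core using 2 <;> push_cast <;> ring_nf
  · obtain ⟨k, rfl⟩ := Nat.exists_eq_add_of_le hvr
    have hrel' : 2 ^ s' * (m * (c - 2 * 2 ^ s' * m)) =
        2 ^ (2 * v') * (q * y₀ ^ 2 - 2 * (2 ^ (2 * k) * d₀ ^ 2)) := by
      rw [hrel]; ring
    obtain ⟨rfl, hrel2⟩ := Int.two_pow_mul_odd_inj hodd1 (hodd2.sub_even (even_two_mul _)) hrel'
    clear hrel hrel' hodd1 hodd2 hodd3
    -- x + c and d contain 2 to the exponents 2v' + 2 and v' + k + 2; their order decides whether i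
    -- or 1 + i is split off from H. As s = 2v, the symbol of 2 modulo α cancels and its index e is
    -- left unevaluated.
    rcases lt_trichotomy k v' with hk | rfl | hk
    · have ha : Even (-(2 ^ (v' - k) * m)) := by
        obtain ⟨l, rfl⟩ := Nat.exists_eq_add_of_lt hk
        exact ⟨-(2 ^ l * m), by rw [show k + l + 1 - k = l + 1 by omega]; ring⟩
      have hα : (⟨x + c, d⟩ : GaussianInt) =
          2 ^ (v' + k + 2) * gaussI ^ 1 * (1 + gaussI) ^ 0 * ⟨d₀, -(2 ^ (v' - k) * m)⟩ := by
        obtain ⟨l, rfl⟩ := Nat.exists_eq_add_of_lt hk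
        rw [GaussianInt.mk_eq, GaussianInt.mk_eq, hxc, hd, show k + l + 1 - k = l + 1 by omega]
        push_cast
        linear_combination (2 ^ (2 * (k + l + 1) + 2) * m : GaussianInt) * gaussI_sq
      obtain ⟨e, he⟩ := HasQuarticIndex.exists_two (GaussianInt.odd_norm_mk hd₀odd ha)
      have core := hmain (v' + k + 2) 1 0 d₀ _ e hd₀odd ha hα he
      obtain ⟨l, rfl⟩ := Nat.exists_eq_add_of_lt hk
      rw [show k + l + 1 - k = l + 1 by omega] at core
      have hw2 : w = 2 * (2 ^ (k + l) * y₀) := by rw [hw]; ring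
      rcases Nat.eq_zero_or_pos (2 * k + l) with h0 | h0
      · obtain ⟨rfl, rfl⟩ : k = 0 ∧ l = 0 := by omega
        refine quarticIndex_arith_eight_exact (δ := δ) (N := m) (N' := m) (x' := x') hcc hmc hqc hy₀ hd₀odd
          (by linear_combination hrel2) (by rw [hδ]; ring) hw2 (a := -(2 ^ (0 + 1) * m)) (by ring)
          (hx''.trans (by ring)) (e := e) ?_
        convert core using 2 <;> push_cast <;> ring
      · refine quarticIndex_arith_large (N := 2 ^ (2 * (k + l)) * m) (N' := 2 ^ (2 * (k + l)) * m)
          (d₀ := 2 ^ (2 * k + l - 1) * d₀) (x' := x') (y₀ := y₀) (a := -(2 ^ (l + 1) * m))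
          (D := 2 ^ (2 * k - 1) * d₀ ^ 2) (E := -(2 ^ (l - 1) * m))
          (e := e) hcc hmc hqc ?_ hy₀ ?_ hw2 (hx''.trans (by ring)) ?_
        · rcases l with _ | l
          · left
            obtain ⟨k', rfl⟩ : ∃ k', k = k' + 1 := ⟨k - 1, by omega⟩
            refine ⟨by ring, ?_⟩
            rw [show 2 * (k' + 1) - 1 = 2 * k' + 1 by omega]
            linear_combination hrel2
          · right
            rw [Nat.add_sub_cancel]
            ring
        · obtain ⟨t, ht⟩ : ∃ t, 2 * k + l = t + 1 := ⟨2 * k + l - 1, by omega⟩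
          rw [hδ, ht, Nat.add_sub_cancel, show k + l + 1 + k = t + 2 by omega]
          ring
        · convert core using 2 <;> push_cast <;> ring
    · obtain ⟨t, ht⟩ := Int.exists_sq_eq_of_odd hm
      obtain ⟨t', ht'⟩ := Int.exists_sq_eq_of_odd hd₀odd
      have hmc' : m * c = q * y₀ ^ 2 + 16 * (2 ^ (2 * k) * (t - t')) := by
        linear_combination hrel2 + 2 * 2 ^ (2 * k) * (ht - ht')
      have hy' : y₀ = 1 + 4 * y₀.primaryQuarter ∨ y₀ = -(1 + 4 * y₀.primaryQuarter) :=
        (Int.primaryQuarter_cases hy₀).imp And.right And.right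
      have hρ : ((2 : ℤ) ^ (2 * k) = 1 ∧ ((k + 1 : ℕ) : ℤ) = 1 ∧ w = y₀) ∨
          ((2 : ℤ) ^ (2 * k) = 4 * 2 ^ (2 * k - 2) ∧ w = 2 * (2 ^ (k - 1) * y₀)) := by
        rcases k with _ | k
        · exact Or.inl ⟨by simp, by simp, by rw [hw]; simp⟩
        · refine Or.inr ⟨?_, ?_⟩
          · rw [show 2 * (k + 1) - 2 = 2 * k by omega]; ring
          · rw [hw, Nat.add_sub_cancel]; ring
      have hδ' : δ = 2 ^ (2 * k) * d₀ := by rw [hδ, two_mul]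
      have hd₀4 : d₀ = 1 + 4 * ((d₀ - 1) / 4) := by omega
      -- H = 2^(2k+2) (m + d₀i) with m, d₀ odd. Since d₀ ≡ 1 (mod 4), the class of m modulo 4
      -- decides which unit makes the imaginary part of the cofactor of 1 + i even.
      rcases hmc with ⟨hm4, hm'⟩ | ⟨hm4, hm'⟩
      · obtain ⟨A, hA⟩ : ∃ A, m + d₀ = 2 * A := ⟨(m + d₀) / 2, by omega⟩
        obtain ⟨B, hB⟩ : ∃ B, d₀ - m = 2 * (2 * B) := ⟨(d₀ - m) / 4, by omega⟩
        have hAo : Odd A := Int.odd_iff.2 (by omega)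
        obtain rfl : m = A - 2 * B := by omega
        obtain rfl : d₀ = A + 2 * B := by omega
        have hα : (⟨x + c, d⟩ : GaussianInt) =
            2 ^ (2 * k + 2) * gaussI ^ 0 * (1 + gaussI) ^ 1 * ⟨A, 2 * B⟩ := by
          rw [GaussianInt.mk_eq, GaussianInt.mk_eq, hxc, hd]
          push_cast
          linear_combination (-2 * (2 ^ (2 * k + 2) * B) : GaussianInt) * gaussI_sq
        obtain ⟨e, he⟩ :=
          HasQuarticIndex.exists_two (GaussianInt.odd_norm_mk hAo (even_two_mul B))
        have core := hmain (2 * k + 2) 0 1 A _ e hAo (even_two_mul B) hα he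
        refine quarticIndex_arith_eq_of_one (a := 2 * B) (e := e) hcc hm4 hm' hqc hy' hmc' hd₀4
          hx'' hδ' hρ rfl ?_
        convert core using 2 <;> push_cast <;> ring
      · obtain ⟨A, hA⟩ : ∃ A, d₀ - m = 2 * A := ⟨(d₀ - m) / 2, by omega⟩
        obtain ⟨B, hB⟩ : ∃ B, -(d₀ + m) = 2 * (2 * B) := ⟨-(d₀ + m) / 4, by omega⟩
        have hAo : Odd A := Int.odd_iff.2 (by omega)
        obtain rfl : m = -A - 2 * B := by omega
        obtain rfl : d₀ = A - 2 * B := by omega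
        have hα : (⟨x + c, d⟩ : GaussianInt) =
            2 ^ (2 * k + 2) * gaussI ^ 1 * (1 + gaussI) ^ 1 * ⟨A, 2 * B⟩ := by
          rw [GaussianInt.mk_eq, GaussianInt.mk_eq, hxc, hd]
          push_cast
          linear_combination (-(2 ^ (2 * k + 2) * (A + 2 * B * (1 + gaussI))) : GaussianInt) * gaussI_sq
        obtain ⟨e, he⟩ :=
          HasQuarticIndex.exists_two (GaussianInt.odd_norm_mk hAo (even_two_mul B))
        have core := hmain (2 * k + 2) 1 1 A _ e hAo (even_two_mul B) hα he
        refine quarticIndex_arith_eq_of_three (a := 2 * B) (e := e) hcc hm4 hm' hqc hy' hmc' hd₀4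
          hx'' hδ' hρ rfl ?_
        convert core using 2 <;> push_cast <;> ring
    · have ha : Even (2 ^ (k - v') * d₀) := by
        obtain ⟨l, rfl⟩ := Nat.exists_eq_add_of_lt hk
        exact ⟨2 ^ l * d₀, by rw [show v' + l + 1 - v' = l + 1 by omega]; ring⟩
      have hα : (⟨x + c, d⟩ : GaussianInt) =
          2 ^ (2 * v' + 2) * gaussI ^ 0 * (1 + gaussI) ^ 0 * ⟨m, 2 ^ (k - v') * d₀⟩ := by
        obtain ⟨l, rfl⟩ := Nat.exists_eq_add_of_lt hk
        rw [GaussianInt.mk_eq, GaussianInt.mk_eq, hxc, hd, show v' + l + 1 - v' = l + 1 by omega]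
        push_cast
        ring
      obtain ⟨e, he⟩ := HasQuarticIndex.exists_two (GaussianInt.odd_norm_mk hm ha)
      have core := hmain (2 * v' + 2) 0 0 m _ e hm ha hα he
      obtain ⟨l, rfl⟩ := Nat.exists_eq_add_of_lt hk
      rw [show v' + l + 1 - v' = l + 1 by omega] at core
      rcases v' with _ | v'
      · obtain rfl : w = y₀ := by rw [hw]; simp
        refine quarticIndex_arith_four_exact (E := 2 ^ l * d₀) (e := e) hcc hmc hqc hy₀
          (N := 2 ^ (2 * l) * d₀ ^ 2) (by linear_combination hrel2) (by rw [hδ]; ring) rfl ?_ rfl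
        rw [show 2 ^ (l + 1) * d₀ = δ by rw [hδ]; ring] at core
        convert core using 2 <;> push_cast <;> ring
      · refine quarticIndex_arith_sixteen_dvd (N' := 2 ^ (2 * v') * m)
          (a := 2 ^ (l + 1) * d₀) (E := 2 ^ l * d₀) (e := e) (n := 2 ^ v' * y₀)
          (d₀ := 2 ^ (2 * v' + l + 1) * d₀) hcc hmc hqc hy₀
          (N := 2 ^ (2 * (v' + l + 1)) * d₀ ^ 2) (by linear_combination hrel2)
          (by rw [hδ]; ring) (by rw [hw]; ring) (by ring) ?_
        convert core using 2 <;> push_cast <;> ring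

/-! ### Proof of the theorem -/

/-- The quartic symbol of `a / b + i` modulo `q` is the one of `a + b i`. -/
theorem HasQuarticIndex.of_rat {a b q k : ℤ} (hq : Odd q) (hb : b ≠ 0) (hbq : IsCoprime b q)
    (h : quarticJacobiSymbolRat ((a : ℚ) / b) 1 q = Complex.I ^ k) :
    HasQuarticIndex (⟨a, b⟩ : GaussianInt) (q : GaussianInt) k := by
  set t : ℚ := (a : ℚ) / b with ht
  have hdvd : (t.den : ℤ) ∣ b := by
    rw [ht, ← Rat.divInt_eq_div]; exact Rat.den_dvd a b
  obtain ⟨s, hs⟩ := hdvd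
  have hdq : IsCoprime (t.den : ℤ) q := by rw [hs] at hbq; exact hbq.of_mul_left_left
  have hsq : IsCoprime s q := by rw [hs] at hbq; exact hbq.of_mul_left_right
  have hden : (t.den : ℤ) ≠ 0 := by exact_mod_cast t.den_nz
  have hnum : t.num * s = a := by
    have h1 : (t.num : ℚ) / t.den = a / b := by rw [Rat.num_div_den]
    rw [div_eq_div_iff (by exact_mod_cast hden) (by exact_mod_cast hb)] at h1
    have h2 : t.num * b = a * t.den := by exact_mod_cast h1
    apply mul_right_cancel₀ hden
    rw [← h2]
    conv_rhs => rw [hs]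
    ring
  have h1 := HasQuarticIndex.intCast hq hdq
  rw [HasQuarticIndex, zpow_zero, Int.cast_natCast] at h1
  have h2 : HasQuarticIndex (⟨t.num, t.den⟩ : GaussianInt) (q : GaussianInt) k := by
    rw [HasQuarticIndex, ← h]
    simp [quarticJacobiSymbolRat, h1]
  have h3 := (HasQuarticIndex.intCast hq hsq).mul_left h2 (GaussianInt.odd_norm_intCast hq)
  rw [zero_add] at h3
  convert h3 using 1
  rw [GaussianInt.mk_eq, GaussianInt.mk_eq, ← hnum]
  conv_lhs => rw [hs]
  push_cast
  ring

/-- The left side is the exponent of t in (-q)^e once the indices of x, 2^v, y₀, i³ and 1 + i are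
collected. -/
theorem quarticIndex_arith_final {c c' δ e v b κ k q' x' X Y : ℤ} (hc : c = 1 + 4 * c')
    (he : e = c' + 2 * c' ^ 2 + 2 * δ ^ 2)
    (h : (X - Y - κ) % 4 = (2 * q' + 2 * (x' * q') + 2 * b + 2 * v * δ + δ + 2 * c') % 4)
    (hk : (2 * q' + κ) % 4 = k % 4) :
    (X - v * (c * (2 * δ)) - Y - 3 * e - (c' - δ)) % 4 = (k + 2 * (x' * q' + b)) % 4 := by
  have h1 := Int.sq_emod_two c'
  have h2 := Int.sq_emod_two δ
  subst hc he
  ring_nf at h ⊢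
  omega

theorem Int.parity_of_eq_sq_add_two_mul_mul_sq {p c d x y q : ℤ} (hp : p % 4 = 1) (hc : c % 4 = 1)
    (hq : Odd q) (hcd : p = c ^ 2 + d ^ 2) (hxy : p = x ^ 2 + 2 * q * y ^ 2) :
    Odd x ∧ Even y ∧ d % 4 = 0 := by
  have hx : Odd x := by
    by_contra hx
    obtain ⟨k, rfl⟩ := Int.not_odd_iff_even.1 hx
    have : p = 2 * (2 * k ^ 2 + q * y ^ 2) := by rw [hxy]; ring
    omega
  obtain ⟨t, ht⟩ := Int.exists_sq_eq_of_odd hx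
  obtain ⟨t', ht'⟩ := Int.exists_sq_eq_of_odd (a := c) (Int.odd_iff.2 (by omega))
  have hy : Even y := by
    by_contra hy
    obtain ⟨k, hk⟩ := hq.mul ((Int.not_even_iff_odd.1 hy).pow (n := 2))
    rw [ht, mul_assoc, hk] at hxy
    omega
  refine ⟨hx, hy, ?_⟩
  obtain ⟨k, rfl⟩ := hy
  have h8 : d ^ 2 = 8 * (t + q * k ^ 2 - t') := by linear_combination hxy - hcd + ht - ht'
  have h2 := Int.sq_emod_two d
  obtain ⟨l, rfl⟩ : ∃ l, d = 2 * l := ⟨d / 2, by omega⟩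
  have h3 := Int.sq_emod_two l
  ring_nf at h8
  omega

theorem theorem4p2 (p : ℕ) [Fact p.Prime] (hp4 : p ≡ 1 [MOD 4])
    (q : ℤ) (hq : Odd q) (hpq : ¬ (p : ℤ) ∣ q)
    (c d x y : ℤ) (hcd : (p : ℤ) = c ^ 2 + d ^ 2) (hxy : (p : ℤ) = x ^ 2 + 2 * q * y ^ 2)
    (hc : c ≡ 1 [ZMOD 4])
    (r : ℕ) (d₀ : ℤ) (hd : d = 2 ^ r * d₀) (hd₀ : d₀ ≡ 1 [ZMOD 4])
    (hgcd : Int.gcd d₀ (x + c) = 1)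
    (k : ℤ) (hk : quarticJacobiSymbolRat (-(d : ℚ) / ((x : ℚ) + (c : ℚ))) 1 q = Complex.I ^ k) :
    (q ≡ 1 [ZMOD 4] →
      (-(q : ZMod p)) ^ ((p - 1) / 8) =
        (-1 : ZMod p) ^ ((x + 1) / 2 * ((q - 1) / 4) + d / 4 + y / 2) *
          ((d : ZMod p) / (c : ZMod p)) ^ k) ∧
    (q ≡ 3 [ZMOD 4] →
      (-(q : ZMod p)) ^ ((p - 1) / 8) =
        (-1 : ZMod p) ^ ((x + 1) / 2 * ((q + 1) / 4)) *
          ((d : ZMod p) / (c : ZMod p)) ^ k) := by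
  have hp : p.Prime := Fact.out
  have hpp : Prime (p : ℤ) := Nat.prime_iff_prime_int.1 hp
  have hc4 : c % 4 = 1 := hc
  have hd₀4 : d₀ % 4 = 1 := hd₀
  have hp4' : (p : ℤ) % 4 = 1 := by have : p % 4 = 1 := hp4; omega
  have hcop : IsCoprime d₀ (x + c) := Int.isCoprime_iff_gcd_eq_one.2 hgcd
  obtain ⟨hx, hyeven, hd4⟩ := Int.parity_of_eq_sq_add_two_mul_mul_sq hp4' hc4 hq hcd hxy
  have hcodd : Odd c := Int.odd_iff.2 (by omega)
  have hd₀odd : Odd d₀ := Int.odd_iff.2 (by omega)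
  have hsq : c ^ 2 + d ^ 2 = x ^ 2 + 2 * q * y ^ 2 := by rw [← hcd, hxy]
  have hy0 : y ≠ 0 := by
    rintro rfl
    have hpx : (p : ℤ) = x * x := by rw [hxy]; ring
    rcases hpp.irreducible.isUnit_or_isUnit hpx with h | h <;>
      exact hpp.not_isUnit (hpx ▸ h.mul h)
  obtain ⟨v, y₀, hy₀, hy⟩ := Int.exists_eq_two_pow_mul_odd hy0
  have hxc0 : x + c ≠ 0 := by
    intro h
    obtain rfl : x = -c := by linarith
    -- x = -c would give d² = 2qy², with an even power of 2 on the left and an odd one on the right.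
    have h1 : 2 ^ (2 * r) * d₀ ^ 2 = 2 ^ (2 * v + 1) * (q * y₀ ^ 2) := by
      rw [hd, hy] at hsq
      linear_combination hsq
    have := (Int.two_pow_mul_odd_inj hd₀odd.pow (hq.mul hy₀.pow) h1).1
    omega
  obtain ⟨v', rfl⟩ : ∃ v', v = v' + 1 := by
    refine ⟨v - 1, (Nat.succ_pred_eq_of_ne_zero ?_).symm⟩
    rintro rfl
    rw [hy, pow_zero, one_mul] at hyeven
    exact Int.not_even_iff_odd.2 hy₀ hyeven
  obtain ⟨r', rfl⟩ : ∃ r', r = r' + 2 := by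
    rcases r with _ | _ | r
    · rw [hd] at hd4; omega
    · rw [hd] at hd4; omega
    · exact ⟨r, rfl⟩
  obtain ⟨δ, hδ⟩ : ∃ δ, δ = 2 ^ r' * d₀ := ⟨_, rfl⟩
  obtain ⟨w, hw⟩ : ∃ w, w = 2 ^ v' * y₀ := ⟨_, rfl⟩
  have hdδ : d = 4 * δ := by rw [hd, hδ]; ring
  have hyw : y = 2 * w := by rw [hy, hw]; ring
  have hcc : c = 1 + 4 * ((c - 1) / 4) := by omega
  set c' := (c - 1) / 4 with hc'
  have hp2 : p ≠ 2 := by rintro rfl; norm_num at hp4'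
  obtain ⟨hpx, hpy⟩ := isCoprime_prime_of_eq_sq_add_two_mul_mul_sq hp hxy hp2 hpq
  have hpy₀ : IsCoprime (p : ℤ) y₀ := by rw [hy] at hpy; exact hpy.of_mul_right_right
  have hqxc : IsCoprime q (x + c) := isCoprime_of_dvd_sq hq hd hcop
    ⟨2 * y ^ 2, x - c, by linear_combination hsq⟩
  have hdeven : Even d := Int.even_iff.2 (by omega)
  have hcd' : IsCoprime c d := by
    -- The value 8 fits because d² = 16δ² = 2 · 8 · δ².
    have := isCoprime_of_eq_sq_add_two_mul_mul_sq (q := 8) hp (x := c) (y := δ) (by rw [hcd, hdδ]; ring)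
    rw [hdδ]
    refine IsCoprime.mul_right ?_ this
    exact (Int.isCoprime_two_right.2 hcodd).pow_right (n := 2)
  -- the prime `c + d i` and its residue field
  have hn : Zsqrtd.norm (⟨c, d⟩ : GaussianInt) = p := by rw [Zsqrtd.norm_def, hcd]; ring
  have hπ : Prime (⟨c, d⟩ : GaussianInt) := GaussianInt.prime_of_norm_eq_prime hp hn
  have hπo : Odd (Zsqrtd.norm (⟨c, d⟩ : GaussianInt)) := GaussianInt.odd_norm_mk hcodd hdeven
  have hcp : (c : ZMod p) ≠ 0 := by
    intro h
    rw [ZMod.intCast_zmod_eq_zero_iff_dvd] at h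
    have h1 : (p : ℤ) ∣ d := by
      refine hpp.dvd_of_dvd_pow (n := 2) ?_
      rw [← dvd_add_right (dvd_pow h two_ne_zero), ← hcd]
    exact hpp.not_isUnit (hcd'.isUnit_of_dvd' h h1)
  have hsum : (c : ZMod p) ^ 2 + (d : ZMod p) ^ 2 = 0 := by
    have := congrArg (Int.cast : ℤ → ZMod p) hcd
    push_cast at this
    rw [← this, ZMod.natCast_self]
  obtain ⟨t, ht⟩ : ∃ t : ZMod p, t = (d : ZMod p) / (c : ZMod p) := ⟨_, rfl⟩
  rw [← ht]
  have htc : t * c = d := by rw [ht, div_mul_cancel₀ _ hcp]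
  have htt : t ^ 2 = -1 := by
    apply mul_right_cancel₀ (pow_ne_zero 2 hcp)
    linear_combination (t * c + d) * htc + hsum
  obtain ⟨φ, hφ⟩ : ∃ φ : GaussianInt →+* ZMod p, φ gaussI = t := by
    refine ⟨Zsqrtd.lift ⟨t, by push_cast; rw [← sq, htt]⟩, ?_⟩
    simp [Zsqrtd.lift, gaussI]
  have hφ0 : φ ⟨c, d⟩ = 0 := by
    rw [GaussianInt.mk_eq, map_add, map_mul, map_intCast, map_intCast, hφ]
    linear_combination (-t) * htc + c * htt
  have h2 := GaussianInt.two_ne_zero_of_odd_norm hπo φ hφ0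
  have ht0 : t ≠ 0 := by rintro rfl; norm_num at htt
  -- the exponents
  obtain ⟨e, he⟩ : ∃ e : ℕ, p = 8 * e + 1 := by
    refine ⟨(p - 1) / 8, ?_⟩
    have : (p : ℤ) = 1 + 8 * (c' + 2 * c' ^ 2 + 2 * δ ^ 2) := by
      rw [hcd, hdδ, hcc]; ring
    omega
  have he' : (e : ℤ) = c' + 2 * c' ^ 2 + 2 * δ ^ 2 := by
    have h1 : (p : ℤ) = 1 + 8 * (c' + 2 * c' ^ 2 + 2 * δ ^ 2) := by
      rw [hcd, hdδ, hcc]; ring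
    omega
  have he4 : ((Zsqrtd.norm (⟨c, d⟩ : GaussianInt)).natAbs - 1) / 4 = 2 * e := by
    rw [hn, Int.natAbs_natCast]; omega
  have he8 : (p - 1) / 8 = e := by omega
  have hπcop : ∀ {n : ℤ}, IsCoprime (p : ℤ) n →
      IsCoprime (n : GaussianInt) (⟨c, d⟩ : GaussianInt) := fun h =>
    (GaussianInt.isCoprime_of_norm (by rwa [hn])).symm
  have hpow : ∀ {α : GaussianInt} {n : ℤ}, IsCoprime α ⟨c, d⟩ → HasQuarticIndex α ⟨c, d⟩ n →
      φ α ^ (2 * e) = t ^ n := by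
    intro α n hα h
    rw [← he4, ← hφ]
    exact (HasQuarticIndex.prime_iff hπ hπo φ hφ0 (GaussianInt.map_ne_zero_of_isCoprime hα φ hφ0)).1 h
  obtain ⟨X, hX⟩ := HasQuarticIndex.exists_of_isCoprime hπo (hπcop hpx)
  obtain ⟨Y, hY⟩ := HasQuarticIndex.exists_of_isCoprime hπo (hπcop hpy₀)
  have hnκ : IsCoprime (⟨x + c, d⟩ : GaussianInt) (q : GaussianInt) := by
    apply GaussianInt.isCoprime_of_norm
    rw [Zsqrtd.norm_def, show (x + c) * (x + c) - -1 * d * d =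
      2 * (x * (x + c)) + q * (2 * y * y) by linear_combination hsq]
    have hqx := isCoprime_left_of_eq_sq_add_two_mul_mul_sq hp hxy hpq
    exact IsCoprime.add_mul_left_left
      ((Int.isCoprime_two_left.2 hq).mul_left (hqx.symm.mul_left hqxc.symm)) _
  obtain ⟨κ, hκ⟩ := HasQuarticIndex.exists_of_isCoprime (GaussianInt.odd_norm_intCast hq) hnκ
  -- -d + (x + c)i = iH, so k differs from κ by the index of i modulo q.
  have hkκ : (2 * q.primaryQuarter + κ) % 4 = k % 4 := by
    have h1 := (HasQuarticIndex.gaussI_intCast hq).mul_left hκ (GaussianInt.odd_norm_intCast hq)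
    rw [show gaussI * (⟨x + c, d⟩ : GaussianInt) = ⟨-d, x + c⟩ by
      rw [GaussianInt.mk_eq, GaussianInt.mk_eq]; push_cast
      linear_combination (d : GaussianInt) * gaussI_sq] at h1
    refine h1.unique (HasQuarticIndex.of_rat hq hxc0 hqxc.symm ?_)
    rw [← hk]; push_cast; rfl
  have hrel := HasQuarticIndex.relation_of_prime hp hcd hxy hc4 hd hd₀4 hq hpq hx hy hy₀ hcop hxc0
    hX hY hκ
  rw [← hδ, ← hw] at hrel
  have hfin := quarticIndex_arith_final hcc he' hrel hkκ
  have hP : ((2 : ℤ) : ZMod p) ^ (2 * e) = t ^ (c * (2 * δ)) := by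
    have h1 := hpow (hπcop (Int.isCoprime_two_left.2 (hn ▸ hπo)).symm)
      (HasQuarticIndex.two_mk hcodd hdeven hcd')
    rw [map_intCast] at h1
    rw [h1, show d / 2 = 2 * δ by omega]
  have hW : (1 + t) ^ (2 * e) = t ^ (c' - δ) := by
    have hcopi : IsCoprime (1 + gaussI) (⟨c, d⟩ : GaussianInt) :=
      (hπcop (Int.isCoprime_two_left.2 (hn ▸ hπo)).symm).of_isCoprime_of_dvd_left
        ⟨1 - gaussI, by have := gaussI_sq; push_cast; linear_combination this⟩
    have h1 := hpow hcopi (HasQuarticIndex.one_add_gaussI_mk hcodd hdeven hcd')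
    rw [map_add, map_one, hφ, if_pos hd4, add_zero] at h1
    have h3 := Int.primaryQuarter_cases hcodd
    have h4 := Int.primaryQuarter_cases (hcodd.add_even hdeven)
    rw [h1]
    congr 1
    omega
  have hXp : (x : ZMod p) ^ (2 * e) = t ^ X := by
    rw [← hpow (hπcop hpx) hX, map_intCast]
  have hYp : (y₀ : ZMod p) ^ (2 * e) = t ^ Y := by
    rw [← hpow (hπcop hpy₀) hY, map_intCast]
  have hmain : (-(q : ZMod p)) ^ e =
      t ^ (X - ((v' + 1 : ℕ) : ℤ) * (c * (2 * δ)) - Y - 3 * e - (c' - δ)) := by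
    have hxp : (x : ZMod p) ^ 2 = -(q : ZMod p) * ((((2 : ℤ) : ZMod p) ^ (v' + 1)) ^ 2 *
        (y₀ : ZMod p) ^ 2 * (t ^ 3 * (1 + t) ^ 2)) := by
      have := congrArg (Int.cast : ℤ → ZMod p) hxy
      rw [hy] at this
      push_cast at this
      rw [ZMod.natCast_self] at this
      -- Quartic symbols give only 2e-th powers. Writing the single factor 2 as t³(1 + t)² makes its
      -- e-th power accessible through (1 + t)^(2e).
      rw [show t ^ 3 * (1 + t) ^ 2 = 2 by linear_combination (t ^ 3 + 2 * t ^ 2 - 2) * htt]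
      push_cast
      linear_combination -this
    have h1 := congrArg (· ^ e) hxp
    simp only [mul_pow _ _ e, ← pow_mul] at h1
    rw [hXp, hYp, hW, show (v' + 1) * 2 * e = 2 * e * (v' + 1) by ring, pow_mul _ (2 * e), hP,
      ← zpow_natCast (t ^ (c * (2 * δ))), ← zpow_natCast t (3 * e), ← zpow_mul,
      ← zpow_add₀ ht0, ← zpow_add₀ ht0, ← zpow_add₀ ht0, ← div_eq_iff (zpow_ne_zero _ ht0),
      ← zpow_sub₀ ht0] at h1
    rw [← h1]
    congr 1
    push_cast
    ring
  -- With -1 = t², both sides of the claim are powers of t, to be compared modulo 4.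
  have hneg : ∀ z : ℤ, (-1 : ZMod p) ^ z * t ^ k = t ^ (k + 2 * z) := by
    intro z
    rw [zpow_add₀ ht0, zpow_mul, show t ^ (2 : ℤ) = -1 by exact_mod_cast htt, mul_comm]
  have hqc := Int.primaryQuarter_cases hq
  rw [he8]
  constructor
  · intro hq1
    have hq1' : q % 4 = 1 := hq1
    rw [hmain, hneg, zpow_eq_zpow_iff_of_sq_eq_neg_one htt h2, hfin, if_pos hq1',
      show (q - 1) / 4 = q.primaryQuarter by omega, show d / 4 = δ by omega,
      show y / 2 = w by omega, add_assoc]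
  · intro hq3
    have hq3' : q % 4 = 3 := hq3
    rw [hmain, hneg, zpow_eq_zpow_iff_of_sq_eq_neg_one htt h2, hfin, if_neg (by omega),
      show (q + 1) / 4 = -q.primaryQuarter by omega]
    ring_nf
    omega
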